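/- Setting. Let $(w_i,u_i)_{i\ge1}$ be i.i.d. on a probability space $(\Omega,\mathcal A,\mathbb P)$, with $w_i$ exponential of mean $1$, $u_i$ uniform on $[0,1]$ and independent of $w_i$, and let $t_i=w_1+\dots+w_i$. Let $q:\mathbb R_+\times\Omega\to\mathbb R_+$ be jointly measurable, let $r_i=\sup\{r:\int_0^r q_s\,ds<t_i\}\in[0,\infty]$, $K=\{(r_i,u_i):i\ge1\}$ and $K_t=K\cap([0,t]\times[0,1])$, and let $\mathcal F=(\mathcal F_t)$ be the natural filtration of $(K_t)$. Let $\sigma_n=\inf\{t:q_t\ge n\}$ and $\zeta=\lim_n\sigma_n$. A localizing sequence for $\zeta$ is an increasing sequence of $\mathcal F$-stopping times with limit $\zeta$. It is assumed that the $\sigma_n$ are stopping times (so that they form a localizing sequence for $\zeta$), and that $q$ is unbounded on $[0,\zeta)$ whenever $\zeta<\infty$. Let $\mathcal X$ be a real Banach space. A process $X$ defined for $t<\zeta$ is a hybrid jump process with data $q,D,\Delta$ and initial value $X_0\in\mathcal X$ if $$X_t=X_0+\int_0^tD_s\,ds+\sum_{(s,u)\in K_t}\Delta_s(u)\qquad(t<\zeta),$$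 where $q$, $D:[0,\zeta)\times\Omega\to\mathcal X$ and $\Delta:[0,\zeta)\times\Omega\to L^\infty([0,1],\mathcal X)$ are progressively measurable with respect to $\mathcal F$, $t\mapsto\Delta_t$ is left-continuous in $L^\infty$ (and $\Delta_s(u)$ is evaluated through a predictable choice of representatives), $(\zeta\wedge\inf\{t:\int_0^t|D_s|\,ds\ge n\})_{n}$ is a localizing sequence for $\zeta$, and for some $c<\infty$, $|\Delta_t(u,\omega)|\le c$ for a.e. $(t,u,\omega)$ with $t<\zeta(\omega)$. A process $Y$ on $[0,\zeta)$ is a local martingale (local submartingale) if there is a localizing sequence $(\tau_n)$ for $\zeta$, with $\tau_n<\zeta$ where $\zeta<\infty$, such that each stopped process $(Y_{t\wedge\tau_n})_{t\ge0}$ is an $\mathcal F$-martingale (submartingale). Theorem (Compensation). Let $X$ be a hybrid jump process with data $q,D,\Delta$, and let its drift be $$\mu_t(X)=D_t+q_t\int_0^1\Delta_t(u)\,du .$$ If $\mu_t(X)=0$ for a.e. $(t,\omega)$ with $t<\zeta(\omega)$, then $X$ is a local martingale on $[0,\zeta)$. If $\mathcal X=\mathbb R$ and $\mu_t(X)\ge0$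 for a.e. $(t,\omega)$ with $t<\zeta(\omega)$, then $X$ is a local submartingale on $[0,\zeta)$. Moreover, for every hybrid jump process $X$ (whatever its drift), the compensated process $$M_t(X)=X_t-X_0-\int_0^t\mu_s(X)\,ds$$ is a local martingale on $[0,\zeta)$. -/

import Mathlib

open MeasureTheory ProbabilityTheory Filter Topology
open scoped NNReal ENNReal

noncomputable section

namespace HybridJump

/-- Lebesgue measure on the half-line `[0, ∞)`. -/
def leb : Measure ℝ≥0 := Measure.comap ((↑) : ℝ≥0 → ℝ) volume

theorem measurableEmbedding_coe : MeasurableEmbedding ((↑) : ℝ≥0 → ℝ) :=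
  NNReal.isClosedEmbedding_coe.measurableEmbedding

instance instSigmaFiniteLeb : SigmaFinite leb :=
  SigmaFinite.of_map leb measurableEmbedding_coe.measurable.aemeasurable (by
    rw [leb, measurableEmbedding_coe.map_comap]
    infer_instance)

/-! ### The marked Poisson process driving everything -/

/-- `(w i, u i)` is an i.i.d. family, each `w i` is exponential with mean `1`, each `u i` is uniform
on `[0, 1]` and independent of `w i`. -/
structure IsMarkedPoisson {Ω : Type*} [mΩ : MeasurableSpace Ω]
    (P : Measure Ω) (w : ℕ → Ω → ℝ) (u : ℕ → Ω → unitInterval) : Prop where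
  measurable_w : ∀ i, Measurable (w i)
  measurable_u : ∀ i, Measurable (u i)
  law_w : ∀ i, P.map (w i) = expMeasure 1
  law_u : ∀ i, P.map (u i) = volume
  indep_pair : ∀ i, IndepFun (w i) (u i) P
  iIndep : iIndepFun (fun i ω => (w i ω, u i ω)) P

/-- The points of the unit rate Poisson process: the `i`-th one (counted from `0`) is
`w 0 + ⋯ + w i`. -/
def poissonPoint {Ω : Type*} (w : ℕ → Ω → ℝ) (i : ℕ) (ω : Ω) : ℝ :=
  ∑ j ∈ Finset.range (i + 1), w j ω

/-- The cumulative rate `∫₀ᵗ q_s ds`, with values in `[0, ∞]`. -/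
def cumRate {Ω : Type*} (q : ℝ≥0 → Ω → ℝ≥0) (t : ℝ≥0) (ω : Ω) : ℝ≥0∞ :=
  ∫⁻ s in Set.Iic t, (q s ω : ℝ≥0∞) ∂leb

/-- The `i`-th jump time `sup {r : ∫₀ʳ q_s ds < w 0 + ⋯ + w i}`; it is `⊤` if there is no such
jump. -/
def jumpTime {Ω : Type*} (w : ℕ → Ω → ℝ) (q : ℝ≥0 → Ω → ℝ≥0) (i : ℕ) (ω : Ω) : WithTop ℝ≥0 :=
  ⨆ (r : ℝ≥0) (_ : cumRate q r ω < ENNReal.ofReal (poissonPoint w i ω)), (r : WithTop ℝ≥0)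

theorem jumpTime_le_iff {Ω : Type*} (w : ℕ → Ω → ℝ) (q : ℝ≥0 → Ω → ℝ≥0) (i : ℕ) (ω : Ω) (s : ℝ≥0) :
    jumpTime w q i ω ≤ s ↔ ∀ k : ℕ,
      ENNReal.ofReal (poissonPoint w i ω) ≤ cumRate q (s + 1 / ((k : ℝ≥0) + 1)) ω := by
  unfold jumpTime
  simp only [iSup_le_iff, WithTop.coe_le_coe]
  constructor
  · intro h k
    by_contra! hk
    have := h _ hk
    have h1 : (0 : ℝ≥0) < 1 / ((k : ℝ≥0) + 1) := by positivity
    exact absurd this (not_le.2 (lt_add_of_pos_right s h1))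
  · intro h r hr
    by_contra! hs
    obtain ⟨k, hk⟩ := exists_nat_one_div_lt (K := ℝ≥0) (tsub_pos_of_lt hs)
    have h2 : s + 1 / ((k : ℝ≥0) + 1) ≤ r := by
      calc s + 1 / ((k : ℝ≥0) + 1) ≤ s + (r - s) := by gcongr
        _ = r := add_tsub_cancel_of_le hs.le
    have h3 : cumRate q (s + 1 / ((k : ℝ≥0) + 1)) ω ≤ cumRate q r ω :=
      lintegral_mono_set (Set.Iic_subset_Iic.2 h2)
    exact absurd hr (not_lt.2 ((h k).trans h3))

theorem measurableSet_jumpTime_le {Ω : Type*} [mΩ : MeasurableSpace Ω]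
    {w : ℕ → Ω → ℝ} {q : ℝ≥0 → Ω → ℝ≥0}
    (hw : ∀ i, Measurable (w i)) (hq : Measurable (Function.uncurry q)) (i : ℕ) (s : ℝ≥0) :
    MeasurableSet {ω | jumpTime w q i ω ≤ s} := by
  simp only [jumpTime_le_iff, Set.ofPred_forall]
  refine MeasurableSet.iInter fun k => measurableSet_le ?_ ?_
  · exact (Finset.measurable_sum _ fun j _ => hw j).ennreal_ofReal
  · exact Measurable.lintegral_prod_left' (μ := leb.restrict _)
      (f := fun p : ℝ≥0 × Ω => (q p.1 p.2 : ℝ≥0∞)) (measurable_coe_nnreal_ennreal.comp hq)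

/-- The natural filtration of the marked point process `K = {(r i, u i)}`, where `r i` is the `i`-th
jump time: at time `t` it is generated by the events that the `i`-th point of `K` lies in
`[0, s] × B`, with `s ≤ t` and `B` Borel. -/
def jumpFiltration {Ω : Type*} [mΩ : MeasurableSpace Ω]
    {w : ℕ → Ω → ℝ} {u : ℕ → Ω → unitInterval} {q : ℝ≥0 → Ω → ℝ≥0}
    (hw : ∀ i, Measurable (w i)) (hu : ∀ i, Measurable (u i))
    (hq : Measurable (Function.uncurry q)) : Filtration ℝ≥0 mΩ where
  seq t := MeasurableSpace.generateFrom
    {S | ∃ (i : ℕ) (s : ℝ≥0) (B : Set unitInterval), s ≤ t ∧ MeasurableSet B ∧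
      S = {ω | jumpTime w q i ω ≤ s ∧ u i ω ∈ B}}
  mono' := by
    intro t t' htt'
    refine MeasurableSpace.generateFrom_mono ?_
    rintro S ⟨i, s, B, hs, hB, rfl⟩
    exact ⟨i, s, B, hs.trans htt', hB, rfl⟩
  le' := by
    intro t
    refine MeasurableSpace.generateFrom_le ?_
    rintro S ⟨i, s, B, -, hB, rfl⟩
    exact (measurableSet_jumpTime_le hw hq i s).inter (hu i hB)

/-! ### Localization on `[0, ζ)` -/

/-- `inf {t : q_t ≥ n}`. -/
def rateHit {Ω : Type*} (q : ℝ≥0 → Ω → ℝ≥0) (n : ℕ) : Ω → WithTop ℝ≥0 :=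
  hittingAfter q (Set.Ici (n : ℝ≥0)) 0

/-- `ζ = lim_n inf {t : q_t ≥ n}` (the limit of a nondecreasing sequence). -/
def explosionTime {Ω : Type*} (q : ℝ≥0 → Ω → ℝ≥0) (ω : Ω) : WithTop ℝ≥0 := ⨆ n, rateHit q n ω

/-- `ζ ∧ inf {t : ∫₀ᵗ |D_s| ds ≥ n}`. -/
def derivHit {Ω : Type*} {E : Type*} [NormedAddCommGroup E]
    (q : ℝ≥0 → Ω → ℝ≥0) (D : ℝ≥0 → Ω → E) (n : ℕ)
    (ω : Ω) : WithTop ℝ≥0 :=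
  min (explosionTime q ω)
    (hittingAfter (fun t ω => ∫⁻ s in Set.Iic t, ‖D s ω‖ₑ ∂leb) (Set.Ici (n : ℝ≥0∞)) 0 ω)

/-- A localizing sequence for `ζ`: stopping times increasing to `ζ`. -/
structure IsLocalizingFor {Ω : Type*} [mΩ : MeasurableSpace Ω]
    (𝓕 : Filtration ℝ≥0 mΩ) (ζ : Ω → WithTop ℝ≥0)
    (τ : ℕ → Ω → WithTop ℝ≥0) : Prop where
  isStoppingTime : ∀ n, IsStoppingTime 𝓕 (τ n)
  monotone : ∀ ω, Monotone fun n => τ n ω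
  tendsto : ∀ ω, Tendsto (fun n => τ n ω) atTop (𝓝 (ζ ω))

/-- The process `X`, of which only the values on `[0, ζ)` matter, has the property `p` locally on
`[0, ζ)`: there is a localizing sequence `τ` for `ζ`, with `τ n < ζ` where `ζ` is finite, such that
each stopped process `X_{t ∧ τ n}` has the property `p`. -/
def LocallyOn {Ω : Type*} [mΩ : MeasurableSpace Ω]
    {E : Type*} (𝓕 : Filtration ℝ≥0 mΩ) (ζ : Ω → WithTop ℝ≥0)
    (p : (ℝ≥0 → Ω → E) → Prop) (X : ℝ≥0 → Ω → E) : Prop :=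
  ∃ τ : ℕ → Ω → WithTop ℝ≥0, IsLocalizingFor 𝓕 ζ τ ∧
    (∀ n ω, τ n ω < ζ ω ∨ ζ ω = ⊤) ∧ ∀ n, p (stoppedProcess X (τ n))

/-- `X` is a local martingale on `[0, ζ)`. -/
def IsLocalMartingaleOn {Ω : Type*} [mΩ : MeasurableSpace Ω]
    {E : Type*} [NormedAddCommGroup E] [NormedSpace ℝ E] [CompleteSpace E]
    (𝓕 : Filtration ℝ≥0 mΩ) (P : Measure Ω) (ζ : Ω → WithTop ℝ≥0) (X : ℝ≥0 → Ω → E) : Prop :=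
  LocallyOn 𝓕 ζ (fun Y => Martingale Y 𝓕 P) X

/-- `X` is a local submartingale on `[0, ζ)`. -/
def IsLocalSubmartingaleOn {Ω : Type*} [mΩ : MeasurableSpace Ω]
    (𝓕 : Filtration ℝ≥0 mΩ) (P : Measure Ω) (ζ : Ω → WithTop ℝ≥0) (X : ℝ≥0 → Ω → ℝ) : Prop :=
  LocallyOn 𝓕 ζ (fun Y => Submartingale Y 𝓕 P) X

/-! ### Hybrid jump processes -/

open scoped Classical in
/-- The process `Y`, set to `0` outside `[0, ζ)`. -/
def before {Ω : Type*} {E : Type*} [Zero E]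
    (ζ : Ω → WithTop ℝ≥0) (Y : ℝ≥0 → Ω → E) (t : ℝ≥0) (ω : Ω) : E :=
  if (t : WithTop ℝ≥0) < ζ ω then Y t ω else 0

/-- Requirements on the transition rate `q`: it is progressively measurable on `[0, ζ)` with respect
to the filtration `𝓕`, the explosion time `ζ` is localized by the times `inf {t : q_t ≥ n}` (that is,
these are stopping times; they increase to `ζ` by definition), and explosion is not abrupt: if `ζ` is
finite then `q` is unbounded on `[0, ζ)`. -/
structure IsTransitionRate {Ω : Type*} [mΩ : MeasurableSpace Ω]
    (𝓕 : Filtration ℝ≥0 mΩ) (q : ℝ≥0 → Ω → ℝ≥0) : Prop where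
  progressive : IsStronglyProgressive 𝓕 (before (explosionTime q) q)
  localizing : IsLocalizingFor 𝓕 (explosionTime q) (rateHit q)
  unbounded : ∀ ω, explosionTime q ω ≠ ⊤ →
    ∀ n : ℕ, ∃ t : ℝ≥0, (t : WithTop ℝ≥0) < explosionTime q ω ∧ (n : ℝ≥0) ≤ q t ω

/-- `X` is a hybrid jump process on `[0, ζ)` with initial value `x₀`, transition rate `q`,
derivative `D` and jump function `Δ`. The values of all processes outside `[0, ζ)` are irrelevant.

The jump function takes values in `L^∞([0, 1], E)`, but is evaluated at the sampled marks `u i`, so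
`Δ t ω : [0, 1] → E` stands for a representative of the class. The representatives are chosen
predictably (every adapted left-continuous process with values in `L^∞` has such a choice);
`predictable` contains the progressive measurability of `Δ`. -/
structure IsHybridJumpProcess {Ω : Type*} [mΩ : MeasurableSpace Ω]
    {E : Type*} [NormedAddCommGroup E] [NormedSpace ℝ E]
    [CompleteSpace E] (P : Measure Ω) (w : ℕ → Ω → ℝ) (u : ℕ → Ω → unitInterval)
    (𝓕 : Filtration ℝ≥0 mΩ) (q : ℝ≥0 → Ω → ℝ≥0) (x₀ : E) (D : ℝ≥0 → Ω → E)
    (Δ : ℝ≥0 → Ω → unitInterval → E) (X : ℝ≥0 → Ω → E) : Prop where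
  rate : IsTransitionRate 𝓕 q
  progressive : IsStronglyProgressive 𝓕 (before (explosionTime q) D)
  predictable : StronglyMeasurable[𝓕.predictable.prod inferInstance]
    fun p : (ℝ≥0 × Ω) × unitInterval => before (explosionTime q) Δ p.1.1 p.1.2 p.2
  memLp : ∀ (t : ℝ≥0) (ω : Ω), (t : WithTop ℝ≥0) < explosionTime q ω → MemLp (Δ t ω) ∞ volume
  leftContinuous : ∀ (t : ℝ≥0) (ω : Ω), (t : WithTop ℝ≥0) < explosionTime q ω →
    Tendsto (fun s => eLpNorm (Δ s ω - Δ t ω) ∞ volume) (𝓝[<] t) (𝓝 0)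
  deriv_localizing : IsLocalizingFor 𝓕 (explosionTime q) (derivHit q D)
  bounded : ∃ c : ℝ, ∀ᵐ p : (ℝ≥0 × Ω) × unitInterval ∂((leb.prod P).prod volume),
    (p.1.1 : WithTop ℝ≥0) < explosionTime q p.1.2 → ‖Δ p.1.1 p.1.2 p.2‖ ≤ c
  eq : ∀ (t : ℝ≥0) (ω : Ω), (t : WithTop ℝ≥0) < explosionTime q ω →
    X t ω = x₀ + ∫ s in Set.Iic t, D s ω ∂leb +
      ∑ᶠ i ∈ {i : ℕ | jumpTime w q i ω ≤ t}, Δ ((jumpTime w q i ω).untopD 0) ω (u i ω)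

/-- The drift `μ_t = D_t + q_t ∫₀¹ Δ_t(u) du`. -/
def drift {Ω : Type*} {E : Type*} [NormedAddCommGroup E] [NormedSpace ℝ E]
    (q : ℝ≥0 → Ω → ℝ≥0) (D : ℝ≥0 → Ω → E) (Δ : ℝ≥0 → Ω → unitInterval → E) (t : ℝ≥0) (ω : Ω) : E :=
  D t ω + (q t ω : ℝ) • ∫ v, Δ t ω v

/-- The compensator `x₀ + ∫₀ᵗ μ_s ds`. -/
def compensator {Ω : Type*} {E : Type*} [NormedAddCommGroup E] [NormedSpace ℝ E]
    (q : ℝ≥0 → Ω → ℝ≥0) (x₀ : E) (D : ℝ≥0 → Ω → E) (Δ : ℝ≥0 → Ω → unitInterval → E)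
    (t : ℝ≥0) (ω : Ω) : E :=
  x₀ + ∫ s in Set.Iic t, drift q D Δ s ω ∂leb

end HybridJump

end

/-!
The proof rests on an identity for the jumps up to a stopping time `τ` with values in `[0, ζ)`:
on predictable sets of times, outcomes and marks, the expected number of jumps up to `τ` is the
integral of `q_t dt dP dv` over `t ≤ τ` (`trim_jumpMeasure_eq`).

The filtration of the jumps is not the filtration of a Poisson process run by a given clock, since
`q` itself depends on the jumps. What makes the exponential law applicable is that before explosion
and before the `i`-th jump (counted from `0`) this filtration knows nothing beyond the first `i`
pairs `(w j, u j)`, up to null events (`agreesBefore`). This is shown by induction on `i`; the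
difficulty is that one must be able to tell from these pairs whether explosion has happened, and one
can because `q` is unbounded before `ζ`, so that the times `rateHit q n` announce `ζ` from inside.
Hence the cumulative rate at `τ`, capped at the `i`-th Poisson point, is the cap of a function `T`
of the first `i` pairs (`exists_measurable_min_cumRate`), and the `i`-th jump occurs by time `τ` if
and only if `w i` is at most the budget `T - (w 0 + ⋯ + w (i - 1))`, of which `w i` and `u i` are
independent. For an exponential variable `w` and a constant `y`, the probability of `w ≤ y` is the
expectation of `min w y` (`lintegral_min_expMeasure_one`), so the probability of the `i`-th jump is
the expected growth of the cumulative rate between the `(i-1)`-st and the `i`-th Poisson point.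
These growths sum up to the cumulative rate at `τ`, which is Wald's identity
(`tsum_measure_jumpTime_le`). Applied to two stopping times that differ only on an event known at
time `s` and only after `s`, it gives the identity of measures on a π-system that generates the
predictable σ-algebra.

Integrating a bounded predictable function over `(s, ∞) × C` with `C` known at time `s` turns the
identity into the martingale property of the compensated sum over the jumps
(`martingale_jumpSum_sub_rateIntegral`), stopped at a time up to which `q` is bounded. A hybrid jump
process is this martingale plus its initial value plus the integral of its drift
(`IsHybridJumpProcess.ae_stopped_eq`). The localizing times are the minima of `rateHit q n` and
`derivHit q D n`: up to them the rate and the integral of `‖D‖` are bounded, and they are smaller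
than `ζ` where `ζ` is finite.
-/

namespace HybridJump

/-! ### Lebesgue measure on the half-line -/

theorem leb_Ioc (a b : ℝ≥0) : leb (Set.Ioc a b) = ((b - a : ℝ≥0) : ℝ≥0∞) := by
  rw [leb, measurableEmbedding_coe.comap_apply]
  have : ((↑) : ℝ≥0 → ℝ) '' Set.Ioc a b = Set.Ioc (a : ℝ) b := by
    ext x
    simp only [Set.mem_image, Set.mem_Ioc]
    constructor
    · rintro ⟨y, ⟨h1, h2⟩, rfl⟩
      exact ⟨by exact_mod_cast h1, by exact_mod_cast h2⟩
    · rintro ⟨h1, h2⟩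
      exact ⟨⟨x, a.2.trans h1.le⟩, ⟨h1, h2⟩, rfl⟩
  rw [this, Real.volume_Ioc, ENNReal.ofReal]
  simp [NNReal.sub_def]

theorem leb_singleton (a : ℝ≥0) : leb {a} = 0 := by
  rw [leb, measurableEmbedding_coe.comap_apply]
  simp

instance instNullSingletonClassLeb : NullSingletonClass leb := ⟨leb_singleton⟩

/-! ### The cumulative rate along a path -/

section Path

variable {Ω : Type*} {w : ℕ → Ω → ℝ} {q : ℝ≥0 → Ω → ℝ≥0} {ω : Ω}

theorem lt_explosionTime_iff {t : ℝ≥0} :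
    (t : WithTop ℝ≥0) < explosionTime q ω ↔ ∃ n, (t : WithTop ℝ≥0) < rateHit q n ω :=
  lt_iSup_iff

theorem rate_lt_of_lt_rateHit {n : ℕ} {s : ℝ≥0} (h : (s : WithTop ℝ≥0) < rateHit q n ω) :
    q s ω < n := by
  have := notMem_of_lt_hittingAfter (u := q) (s := Set.Ici (n : ℝ≥0)) h zero_le
  simpa using this

theorem rateHit_le_of_le {n : ℕ} {s : ℝ≥0} (h : (n : ℝ≥0) ≤ q s ω) : rateHit q n ω ≤ s :=
  hittingAfter_le_of_mem zero_le h

theorem rateHit_le_explosionTime (n : ℕ) : rateHit q n ω ≤ explosionTime q ω :=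
  le_iSup (fun n => rateHit q n ω) n

theorem cumRate_mono {s t : ℝ≥0} (h : s ≤ t) : cumRate q s ω ≤ cumRate q t ω :=
  lintegral_mono_set (Set.Iic_subset_Iic.2 h)

theorem cumRate_zero : cumRate q 0 ω = 0 := by
  rw [cumRate, ← bot_eq_zero, Set.Iic_bot, Measure.restrict_singleton, bot_eq_zero, leb_singleton]
  simp

/-- Up to the time `inf {t : q_t ≥ n}` the cumulative rate is Lipschitz with constant `n`. -/
theorem cumRate_le_add {n : ℕ} {s t : ℝ≥0} (hst : s ≤ t) (ht : (t : WithTop ℝ≥0) ≤ rateHit q n ω) :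
    cumRate q t ω ≤ cumRate q s ω + n * ((t - s : ℝ≥0) : ℝ≥0∞) := by
  have h1 : Set.Iic t = Set.Iic s ∪ Set.Ioc s t := (Set.Iic_union_Ioc_eq_Iic hst).symm
  rw [cumRate, h1, lintegral_union measurableSet_Ioc]
  · refine add_le_add le_rfl ?_
    rw [← restrict_Ioo_eq_restrict_Ioc]
    calc ∫⁻ r in Set.Ioo s t, (q r ω : ℝ≥0∞) ∂leb ≤ ∫⁻ _ in Set.Ioo s t, (n : ℝ≥0∞) ∂leb := by
          refine setLIntegral_mono measurable_const fun r hr => ?_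
          have : q r ω < n :=
            rate_lt_of_lt_rateHit ((WithTop.coe_lt_coe.2 hr.2).trans_le ht)
          exact_mod_cast this.le
      _ = n * leb (Set.Ioo s t) := by simp
      _ ≤ n * leb (Set.Ioc s t) := by gcongr; exact Set.Ioo_subset_Ioc_self
      _ = _ := by rw [leb_Ioc]
  · rw [Set.disjoint_left]
    intro x hx hx'
    exact absurd hx'.1 (not_lt.2 hx)

theorem cumRate_le_mul {n : ℕ} {t : ℝ≥0} (ht : (t : WithTop ℝ≥0) ≤ rateHit q n ω) :
    cumRate q t ω ≤ n * t := by
  simpa [cumRate_zero] using cumRate_le_add zero_le ht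

theorem cumRate_lt_top {t : ℝ≥0} (ht : (t : WithTop ℝ≥0) < explosionTime q ω) :
    cumRate q t ω < ∞ := by
  obtain ⟨n, hn⟩ := lt_explosionTime_iff.1 ht
  exact (cumRate_le_mul hn.le).trans_lt (by finiteness)

/-- Right-continuity of the cumulative rate before explosion. -/
theorem exists_gt_cumRate_lt {t : ℝ≥0} (ht : (t : WithTop ℝ≥0) < explosionTime q ω) {b : ℝ≥0∞}
    (hb : cumRate q t ω < b) :
    ∃ t', t < t' ∧ (t' : WithTop ℝ≥0) < explosionTime q ω ∧ cumRate q t' ω < b := by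
  obtain ⟨n, hn⟩ := lt_explosionTime_iff.1 ht
  have h1 : Tendsto (fun t' : ℝ≥0 => cumRate q t ω + n * ((t' - t : ℝ≥0) : ℝ≥0∞)) (𝓝[>] t)
      (𝓝 (cumRate q t ω + n * ((t - t : ℝ≥0) : ℝ≥0∞))) := by
    refine Tendsto.mono_left ?_ nhdsWithin_le_nhds
    refine Tendsto.add tendsto_const_nhds (ENNReal.Tendsto.const_mul ?_ (by simp))
    exact (ENNReal.continuous_coe.comp (by fun_prop : Continuous fun t' : ℝ≥0 => t' - t)).tendsto t
  simp only [tsub_self, ENNReal.coe_zero, mul_zero, add_zero] at h1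
  have h2 : ∀ᶠ t' : ℝ≥0 in 𝓝[>] t, (t' : WithTop ℝ≥0) < rateHit q n ω := by
    rcases eq_or_ne (rateHit q n ω) ⊤ with h | h
    · simp only [h, WithTop.coe_lt_top, eventually_true]
    · lift rateHit q n ω to ℝ≥0 using h with r
      simp only [WithTop.coe_lt_coe] at hn ⊢
      exact (eventually_lt_nhds hn).filter_mono nhdsWithin_le_nhds
  obtain ⟨t', h3, h4, h5⟩ := (h2.and ((h1.eventually_lt_const hb).and
    self_mem_nhdsWithin)).exists
  exact ⟨t', h5, h3.trans_le (rateHit_le_explosionTime n),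
    (cumRate_le_add (le_of_lt h5) h3.le).trans_lt h4⟩

/-- Left-continuity of the cumulative rate before explosion, along a dense set. -/
theorem exists_denseSeq_lt_cumRate {t : ℝ≥0} (ht : (t : WithTop ℝ≥0) < explosionTime q ω)
    {b : ℝ≥0∞} (hb : b < cumRate q t ω) :
    ∃ k, TopologicalSpace.denseSeq ℝ≥0 k < t ∧
      b < cumRate q (TopologicalSpace.denseSeq ℝ≥0 k) ω := by
  obtain ⟨n, hn⟩ := lt_explosionTime_iff.1 ht
  have ht0 : 0 < t := by
    rw [pos_iff_ne_zero]
    rintro rfl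
    simp [cumRate_zero] at hb
  have h1 : Tendsto (fun s : ℝ≥0 => b + n * ((t - s : ℝ≥0) : ℝ≥0∞)) (𝓝[<] t)
      (𝓝 (b + n * ((t - t : ℝ≥0) : ℝ≥0∞))) := by
    refine Tendsto.mono_left ?_ nhdsWithin_le_nhds
    refine Tendsto.add tendsto_const_nhds (ENNReal.Tendsto.const_mul ?_ (by simp))
    exact (ENNReal.continuous_coe.comp (by fun_prop : Continuous fun s : ℝ≥0 => t - s)).tendsto t
  simp only [tsub_self, ENNReal.coe_zero, mul_zero, add_zero] at h1
  have h2 := h1.eventually_lt_const hb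
  obtain ⟨l, hl, hl'⟩ := (mem_nhdsLT_iff_exists_Ioo_subset' ht0).1 h2
  obtain ⟨_, ⟨k, rfl⟩, hk⟩ :=
    (TopologicalSpace.denseRange_denseSeq ℝ≥0).exists_between hl
  refine ⟨k, hk.2, ?_⟩
  have h3 := (hl' hk).trans_le (cumRate_le_add hk.2.le hn.le)
  exact lt_of_add_lt_add_right h3

/-- Before explosion, the `i`-th jump has happened when the cumulative rate has reached the `i`-th
Poisson point. -/
theorem jumpTime_le_iff_le_cumRate {i : ℕ} {t : ℝ≥0}
    (ht : (t : WithTop ℝ≥0) < explosionTime q ω) :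
    jumpTime w q i ω ≤ t ↔ ENNReal.ofReal (poissonPoint w i ω) ≤ cumRate q t ω := by
  constructor
  · intro h
    by_contra! hlt
    obtain ⟨t', h1, -, h2⟩ := exists_gt_cumRate_lt ht hlt
    have : (t' : WithTop ℝ≥0) ≤ jumpTime w q i ω :=
      le_iSup₂ (f := fun (r : ℝ≥0) (_ : cumRate q r ω < ENNReal.ofReal (poissonPoint w i ω)) =>
        (r : WithTop ℝ≥0)) t' h2
    exact absurd (WithTop.coe_le_coe.1 (this.trans h)) (not_le.2 h1)
  · intro h
    refine iSup₂_le fun r hr => WithTop.coe_le_coe.2 ?_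
    by_contra! hlt
    exact absurd (hr.trans_le h) (not_lt.2 (cumRate_mono hlt.le))

/-- The cumulative rate comes up to the `i`-th Poisson point strictly before the `i`-th jump. -/
theorem ofReal_poissonPoint_le_iSup {i : ℕ} {t : ℝ≥0}
    (ht : (t : WithTop ℝ≥0) < explosionTime q ω)
    (hi : ENNReal.ofReal (poissonPoint w i ω) ≤ cumRate q t ω) {b : ℝ≥0∞}
    (hb : b < ENNReal.ofReal (poissonPoint w i ω)) :
    ∃ k, TopologicalSpace.denseSeq ℝ≥0 k < t ∧ b < cumRate q (TopologicalSpace.denseSeq ℝ≥0 k) ω ∧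
      ∀ s ≤ TopologicalSpace.denseSeq ℝ≥0 k,
        cumRate q s ω < ENNReal.ofReal (poissonPoint w i ω) := by
  have h1 := (jumpTime_le_iff_le_cumRate (w := w) (i := i) ht).2 hi
  obtain ⟨r, hr⟩ := WithTop.ne_top_iff_exists.1 (ne_top_of_le_ne_top WithTop.coe_ne_top h1)
  rw [← hr, WithTop.coe_le_coe] at h1
  have h2 : (r : WithTop ℝ≥0) < explosionTime q ω := (WithTop.coe_le_coe.2 h1).trans_lt ht
  have h3 := (jumpTime_le_iff_le_cumRate (w := w) (i := i) h2).1 hr.ge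
  obtain ⟨k, hk, hk'⟩ := exists_denseSeq_lt_cumRate h2 (hb.trans_le h3)
  refine ⟨k, hk.trans_le h1, hk', fun s hs => ?_⟩
  have hs' : s < r := hs.trans_lt hk
  by_contra! hlt
  have h4 := (jumpTime_le_iff_le_cumRate (w := w) (i := i)
    ((WithTop.coe_lt_coe.2 hs').trans h2)).2 hlt
  rw [← hr, WithTop.coe_le_coe] at h4
  exact absurd h4 (not_le.2 hs')

end Path

/-! ### The filtration before a jump -/

theorem ae_pos_expMeasure_one : ∀ᵐ x ∂(expMeasure 1), 0 < x := by
  have := isProbabilityMeasure_expMeasure (r := 1) one_pos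
  have h2 : (expMeasure 1) (Set.Iic 0) = 0 := by
    have := cdf_expMeasure_eq (r := 1) one_pos 0
    rw [cdf_eq_real] at this
    simpa [measureReal_eq_zero_iff] using this
  rw [ae_iff]
  simpa [Set.Iic] using h2

section History

variable {Ω : Type*}

/-- The σ-algebra generated by `(w j, u j)` for `j < i`. -/
@[reducible]
def history (w : ℕ → Ω → ℝ) (u : ℕ → Ω → unitInterval) (i : ℕ) : MeasurableSpace Ω :=
  ⨆ j ∈ Set.Iio i, MeasurableSpace.comap (fun ω => (w j ω, u j ω)) inferInstance

/-- The event that at time `t` neither explosion nor the `i`-th jump has happened yet. -/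
def beforeJump (w : ℕ → Ω → ℝ) (q : ℝ≥0 → Ω → ℝ≥0) (i : ℕ) (t : ℝ≥0) : Set Ω :=
  {ω | (t : WithTop ℝ≥0) < explosionTime q ω ∧ cumRate q t ω < ENNReal.ofReal (poissonPoint w i ω)}

variable {w : ℕ → Ω → ℝ} {u : ℕ → Ω → unitInterval} {q : ℝ≥0 → Ω → ℝ≥0}

theorem beforeJump_anti {i : ℕ} {s t : ℝ≥0} (h : s ≤ t) :
    beforeJump w q i t ⊆ beforeJump w q i s := fun _ hω =>
  ⟨(WithTop.coe_le_coe.2 h).trans_lt hω.1, (cumRate_mono h).trans_lt hω.2⟩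

theorem history_mono {i j : ℕ} (h : i ≤ j) : history w u i ≤ history w u j :=
  biSup_mono fun _ hk => lt_of_lt_of_le hk h

theorem measurable_pair_history {i j : ℕ} (h : j < i) :
    Measurable[history w u i] fun ω => (w j ω, u j ω) :=
  (comap_measurable _).mono (le_biSup (fun j => MeasurableSpace.comap (fun ω => (w j ω, u j ω))
    inferInstance) (show j ∈ Set.Iio i from h)) le_rfl

theorem measurable_poissonPoint_history {i j : ℕ} (h : j < i) :
    Measurable[history w u i] (poissonPoint w j) := by
  unfold poissonPoint
  refine Finset.measurable_sum _ fun k hk => ?_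
  exact measurable_fst.comp (measurable_pair_history
    ((Nat.lt_succ_iff.1 (Finset.mem_range.1 hk)).trans_lt h))

theorem poissonPoint_mono {ω : Ω} (h : ∀ i, 0 < w i ω) : Monotone fun i => poissonPoint w i ω :=
  monotone_nat_of_le_succ fun i => by
    simp only [poissonPoint, Finset.sum_range_succ _ (i + 1)]
    linarith [h (i + 1)]

theorem before_of_lt {E : Type*} [Zero E] {ζ : Ω → WithTop ℝ≥0} {Y : ℝ≥0 → Ω → E} {t : ℝ≥0} {ω : Ω}
    (h : (t : WithTop ℝ≥0) < ζ ω) : before ζ Y t ω = Y t ω := if_pos h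

theorem before_of_not_lt {E : Type*} [Zero E] {ζ : Ω → WithTop ℝ≥0} {Y : ℝ≥0 → Ω → E} {t : ℝ≥0}
    {ω : Ω} (h : ¬ (t : WithTop ℝ≥0) < ζ ω) : before ζ Y t ω = 0 := if_neg h

variable [mΩ : MeasurableSpace Ω] {P : Measure Ω}

theorem IsMarkedPoisson.measurable_pair (h : IsMarkedPoisson P w u) (i : ℕ) :
    Measurable fun ω => (w i ω, u i ω) := (h.measurable_w i).prodMk (h.measurable_u i)

theorem IsMarkedPoisson.history_le (h : IsMarkedPoisson P w u) (i : ℕ) : history w u i ≤ mΩ :=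
  iSup₂_le fun j _ => (h.measurable_pair j).comap_le

theorem IsMarkedPoisson.indep_history (h : IsMarkedPoisson P w u) (i : ℕ) :
    Indep (history w u i) (MeasurableSpace.comap (fun ω => (w i ω, u i ω)) inferInstance) P := by
  have := indep_iSup_of_disjoint (fun j => (h.measurable_pair j).comap_le) h.iIndep
    (S := Set.Iio i) (T := {i}) (by simp)
  rwa [iSup_singleton] at this

theorem IsMarkedPoisson.ae_pos (h : IsMarkedPoisson P w u) : ∀ᵐ ω ∂P, ∀ i, 0 < w i ω := by
  rw [ae_all_iff]
  intro i
  have h1 := ae_pos_expMeasure_one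
  rw [← h.law_w i] at h1
  exact ae_of_ae_map (h.measurable_w i).aemeasurable h1

instance instSigmaFiniteLebIic (t : ℝ≥0) :
    SigmaFinite (leb.comap (Subtype.val : Set.Iic t → ℝ≥0)) :=
  SigmaFinite.of_map _ measurable_subtype_coe.aemeasurable (by
    rw [map_comap_subtype_coe measurableSet_Iic]
    infer_instance)

theorem stronglyMeasurable_setIntegral_of_progressive {𝓕 : Filtration ℝ≥0 mΩ} {E : Type*}
    [NormedAddCommGroup E] [NormedSpace ℝ E] {Y : ℝ≥0 → Ω → E}
    (hY : IsStronglyProgressive 𝓕 Y) (t : ℝ≥0) :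
    StronglyMeasurable[𝓕 t] fun ω => ∫ s in Set.Iic t, Y s ω ∂leb := by
  have h1 := hY t
  simp_rw [← integral_subtype_comap measurableSet_Iic]
  exact @StronglyMeasurable.integral_prod_left' _ _ _ _ (𝓕 t) (leb.comap _) _ _ _ _ h1

/-- The cumulative rate is adapted before explosion. -/
theorem exists_measurable_eq_cumRate {𝓕 : Filtration ℝ≥0 mΩ}
    (hY : IsStronglyProgressive 𝓕 (before (explosionTime q) q)) (t : ℝ≥0) :
    ∃ A : Ω → ℝ≥0∞, Measurable[𝓕 t] A ∧
      ∀ ω, (t : WithTop ℝ≥0) < explosionTime q ω → A ω = cumRate q t ω := by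
  refine ⟨fun ω => ∫⁻ s in Set.Iic t, ((before (explosionTime q) q s ω : ℝ≥0) : ℝ≥0∞) ∂leb, ?_,
    fun ω hω => ?_⟩
  · have h1 := (hY t).measurable.coe_nnreal_ennreal
    simp_rw [← lintegral_subtype_comap measurableSet_Iic]
    exact @Measurable.lintegral_prod_left' _ _ _ (𝓕 t) (leb.comap _) _ _ h1
  refine setLIntegral_congr_fun measurableSet_Iic fun s hs => ?_
  have : (s : WithTop ℝ≥0) < explosionTime q ω := (WithTop.coe_le_coe.2 hs).trans_lt hω
  simp only [before_of_lt this]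

/-- The event `C` coincides, up to a null event, with an event of the first `i` interarrival times
and marks as long as neither explosion nor the `i`-th jump has happened at time `t`. -/
def AgreesBefore (P : Measure Ω) (w : ℕ → Ω → ℝ) (u : ℕ → Ω → unitInterval)
    (q : ℝ≥0 → Ω → ℝ≥0) (i : ℕ) (t : ℝ≥0) (C : Set Ω) : Prop :=
  ∃ C', MeasurableSet[history w u i] C' ∧ ∀ᵐ ω ∂P, ω ∈ beforeJump w q i t → (ω ∈ C ↔ ω ∈ C')

/-- Up to a null event, it is known from the first `i` interarrival times and marks whether at time
`t` the `i`-th jump (counted from `0`) or explosion has happened. -/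
def JumpDetermined (P : Measure Ω) (w : ℕ → Ω → ℝ) (u : ℕ → Ω → unitInterval)
    (q : ℝ≥0 → Ω → ℝ≥0) (i : ℕ) : Prop :=
  ∀ t, ∃ V, MeasurableSet[history w u (i + 1)] V ∧ ∀ᵐ ω ∂P, ω ∈ beforeJump w q i t ↔ ω ∈ V

theorem agreesBefore_of_jumpDetermined (hwu : IsMarkedPoisson P w u)
    (hq : Measurable (Function.uncurry q)) {i : ℕ} (h : ∀ j < i, JumpDetermined P w u q j)
    {t : ℝ≥0} {C : Set Ω}
    (hC : MeasurableSet[jumpFiltration hwu.measurable_w hwu.measurable_u hq t] C) :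
    AgreesBefore P w u q i t C := by
  refine MeasurableSpace.generateFrom_induction _ (fun C _ => AgreesBefore P w u q i t C)
    ?_ ?_ ?_ ?_ C hC
  · rintro _ ⟨k, s, B, hs, hB, rfl⟩ -
    rcases lt_or_ge k i with hk | hk
    · obtain ⟨V, hV, hV'⟩ := h k hk s
      refine ⟨Vᶜ ∩ u k ⁻¹' B, ?_, ?_⟩
      · refine MeasurableSet.inter (history_mono (Nat.succ_le_of_lt hk) _ hV).compl ?_
        exact (measurable_snd.comp (measurable_pair_history (w := w) (u := u) hk)) hB
      · filter_upwards [hV'] with ω hω hU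
        have hs' : (s : WithTop ℝ≥0) < explosionTime q ω :=
          (WithTop.coe_le_coe.2 hs).trans_lt hU.1
        have : jumpTime w q k ω ≤ s ↔ ω ∉ V := by
          rw [jumpTime_le_iff_le_cumRate hs', ← hω, beforeJump, Set.mem_ofPred_eq, not_and, not_lt]
          exact ⟨fun h _ => h, fun h => h hs'⟩
        simp only [this, Set.mem_inter_iff, Set.mem_compl_iff, Set.mem_preimage]
    · refine ⟨∅, @MeasurableSet.empty _ (_), ?_⟩
      filter_upwards [hwu.ae_pos] with ω hω hU
      simp only [Set.mem_empty_iff_false, iff_false, not_and]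
      intro hle
      exfalso
      have hs' : (s : WithTop ℝ≥0) < explosionTime q ω :=
          (WithTop.coe_le_coe.2 hs).trans_lt hU.1
      rw [jumpTime_le_iff_le_cumRate hs'] at hle
      have h1 := ENNReal.ofReal_le_ofReal (poissonPoint_mono hω hk)
      exact absurd (hU.2.trans_le (h1.trans (hle.trans (cumRate_mono hs)))) (lt_irrefl _)
  · exact ⟨∅, @MeasurableSet.empty _ (_), by simp⟩
  · rintro C - ⟨C', hC', h'⟩
    refine ⟨C'ᶜ, hC'.compl, ?_⟩
    filter_upwards [h'] with ω hω hU
    simp [hω hU]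
  · intro C _ hC
    choose C' hC' h' using hC
    refine ⟨⋃ n, C' n, MeasurableSet.iUnion hC', ?_⟩
    filter_upwards [ae_all_iff.2 h'] with ω hω hU
    simp [fun n => hω n hU]

/-- Functional version of `AgreesBefore`. -/
theorem exists_measurable_agrees {𝓕 : Filtration ℝ≥0 mΩ} {i : ℕ} {t : ℝ≥0}
    (h : ∀ C, MeasurableSet[𝓕 t] C → AgreesBefore P w u q i t C) {f : Ω → ℝ≥0∞}
    (hf : Measurable[𝓕 t] f) :
    ∃ g : Ω → ℝ≥0∞, Measurable[history w u i] g ∧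
      ∀ᵐ ω ∂P, ω ∈ beforeJump w q i t → f ω = g ω := by
  have h1 : ∀ k : ℕ, AgreesBefore P w u q i t
      {ω | (TopologicalSpace.denseSeq ℝ≥0 k : ℝ≥0∞) < f ω} := fun k =>
    h _ (hf measurableSet_Ioi)
  choose C hC hC' using h1
  refine ⟨fun ω => ⨆ k, (C k).indicator (fun _ => (TopologicalSpace.denseSeq ℝ≥0 k : ℝ≥0∞)) ω,
    .iSup fun k => measurable_const.indicator (hC k), ?_⟩
  filter_upwards [ae_all_iff.2 hC'] with ω hω hU
  have hω' := fun k => hω k hU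
  apply le_antisymm
  · refine le_of_forall_lt fun b hb => ?_
    obtain ⟨c, hbc, hcf⟩ := ENNReal.lt_iff_exists_nnreal_btwn.1 hb
    obtain ⟨c', hcc', hcf'⟩ := ENNReal.lt_iff_exists_nnreal_btwn.1 hcf
    obtain ⟨_, ⟨k, rfl⟩, hk⟩ := (TopologicalSpace.denseRange_denseSeq ℝ≥0).exists_between
      (ENNReal.coe_lt_coe.1 hcc')
    have h2 : ω ∈ C k := (hω' k).1 ((ENNReal.coe_lt_coe.2 hk.2).trans hcf')
    refine (hbc.trans (ENNReal.coe_lt_coe.2 hk.1)).trans_le ?_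
    refine le_trans ?_ (le_iSup _ k)
    simp [h2]
  · refine iSup_le fun k => ?_
    by_cases hk : ω ∈ C k
    · simpa [hk] using ((hω' k).2 hk).le
    · simp [hk]

/-- If the events before the `i`-th jump are determined by the first `i` interarrival times and
marks, then so is the `i`-th jump, given the `i`-th interarrival time. That explosion can be
recognized from inside `[0, ζ)` is due to the times `rateHit q n`, which increase to `ζ` and lie
strictly before it. -/
theorem jumpDetermined_of_agreesBefore {𝓕 : Filtration ℝ≥0 mΩ} {i : ℕ}
    (h : ∀ t C, MeasurableSet[𝓕 t] C → AgreesBefore P w u q i t C) (hq : IsTransitionRate 𝓕 q) :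
    JumpDetermined P w u q i := by
  intro t
  let d := TopologicalSpace.denseSeq ℝ≥0
  have h1 : ∀ k, ∃ g : Ω → ℝ≥0∞, Measurable[history w u i] g ∧
      ∀ᵐ ω ∂P, ω ∈ beforeJump w q i (d k) → cumRate q (d k) ω = g ω := fun k => by
    obtain ⟨A, hA, hA'⟩ := exists_measurable_eq_cumRate hq.progressive (d k)
    obtain ⟨g, hg, hg'⟩ := exists_measurable_agrees (h (d k)) hA
    refine ⟨g, hg, ?_⟩
    filter_upwards [hg'] with ω hω hU
    rw [← hω hU, hA' ω hU.1]
  choose g hg hg' using h1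
  have h2 : ∀ n k, AgreesBefore P w u q i (d k) {ω | rateHit q n ω ≤ d k} := fun n k =>
    h _ _ (hq.localizing.isStoppingTime n (d k))
  choose C hC hC' using h2
  -- Explosion or the jump has happened by time `t` if each `rateHit q n` is at most some `d k < t`,
  -- or if the cumulative rate, followed along `d k < t`, comes up to the `i`-th Poisson point.
  refine ⟨((⋂ n, ⋃ k, {ω | d k < t ∧ ω ∈ C n k}) ∪
    {ω | ENNReal.ofReal (poissonPoint w i ω) ≤ ⨆ k, ⨆ (_ : d k < t), g k ω})ᶜ, ?_, ?_⟩
  · refine MeasurableSet.compl (MeasurableSet.union ?_ ?_)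
    · refine MeasurableSet.iInter fun n => MeasurableSet.iUnion fun k => ?_
      exact (MeasurableSet.const _).inter (history_mono (Nat.le_succ i) _ (hC n k))
    · refine measurableSet_le ?_ ?_
      · exact (measurable_poissonPoint_history (Nat.lt_succ_self i)).ennreal_ofReal
      · exact .iSup fun k => .iSup fun _ => (hg k).mono (history_mono (Nat.le_succ i)) le_rfl
  · filter_upwards [ae_all_iff.2 hg', ae_all_iff.2 fun n => ae_all_iff.2 (hC' n)] with ω h3 h4
    rw [← not_iff_not, Set.notMem_compl_iff]
    simp only [Set.mem_union, Set.mem_iInter, Set.mem_iUnion, Set.mem_ofPred_eq]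
    constructor
    · intro hU
      by_cases hs : ∃ s ≤ t, (s : WithTop ℝ≥0) < explosionTime q ω ∧
          ENNReal.ofReal (poissonPoint w i ω) ≤ cumRate q s ω
      · right
        obtain ⟨s, hst, hs, hs'⟩ := hs
        refine le_of_forall_lt fun b hb => ?_
        obtain ⟨k, hk, hk', hk''⟩ := ofReal_poissonPoint_le_iSup hs hs' hb
        refine hk'.trans_le ?_
        rw [h3 k ⟨(WithTop.coe_lt_coe.2 hk).trans hs, hk'' _ le_rfl⟩]
        exact le_iSup₂ (f := fun k (_ : d k < t) => g k ω) k (hk.trans_le hst)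
      · left
        push Not at hs
        have hζ : explosionTime q ω ≤ t := by
          by_contra! hlt
          exact hU ⟨hlt, hs t le_rfl hlt⟩
        obtain ⟨z, hz⟩ := WithTop.ne_top_iff_exists.1 (ne_top_of_le_ne_top WithTop.coe_ne_top hζ)
        intro n
        obtain ⟨r, hr, hr'⟩ := hq.unbounded ω (by rw [← hz]; exact WithTop.coe_ne_top) n
        have hr2 := rateHit_le_of_le hr'
        rw [← hz, WithTop.coe_lt_coe] at hr
        rw [← hz, WithTop.coe_le_coe] at hζ
        obtain ⟨_, ⟨k, rfl⟩, hk⟩ :=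
          (TopologicalSpace.denseRange_denseSeq ℝ≥0).exists_between hr
        have hk2 : ((d k : ℝ≥0) : WithTop ℝ≥0) < explosionTime q ω := by
          rw [← hz]; exact WithTop.coe_lt_coe.2 hk.2
        refine ⟨k, hk.2.trans_le hζ, (h4 n k ⟨hk2, hs _ (hk.2.trans_le hζ).le hk2⟩).1 ?_⟩
        exact hr2.trans (WithTop.coe_le_coe.2 hk.1.le)
    · rintro hbad hU
      rcases hbad with hbad | hbad
      · have : explosionTime q ω ≤ t := by
          refine iSup_le fun n => ?_
          obtain ⟨k, hk, hk'⟩ := hbad n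
          exact ((h4 n k (beforeJump_anti hk.le hU)).2 hk').trans (WithTop.coe_le_coe.2 hk.le)
        exact absurd hU.1 (not_lt.2 this)
      · refine absurd (hU.2.trans_le hbad) (not_lt.2 (iSup₂_le fun k hk => ?_))
        rw [← h3 k (beforeJump_anti hk.le hU)]
        exact cumRate_mono hk.le

/-- Before the `i`-th jump and before explosion, the filtration of the jumps only contains
information on the first `i` interarrival times and marks. -/
theorem agreesBefore (hwu : IsMarkedPoisson P w u)
    (hq : Measurable (Function.uncurry q))
    (hrate : IsTransitionRate (jumpFiltration hwu.measurable_w hwu.measurable_u hq) q) (i : ℕ)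
    {t : ℝ≥0} {C : Set Ω}
    (hC : MeasurableSet[jumpFiltration hwu.measurable_w hwu.measurable_u hq t] C) :
    AgreesBefore P w u q i t C := by
  have h : ∀ j, JumpDetermined P w u q j := fun j => by
    induction j using Nat.strong_induction_on with
    | _ j ih =>
      exact jumpDetermined_of_agreesBefore
        (fun t C hC => agreesBefore_of_jumpDetermined hwu hq ih hC) hrate
  exact agreesBefore_of_jumpDetermined hwu hq (fun j _ => h j) hC

/-- For a stopping time `τ < ζ`, the cumulative rate at `τ`, as long as it does not exceed the
`i`-th Poisson point, is a function of the first `i` interarrival times and marks. -/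
theorem exists_measurable_min_cumRate {𝓕 : Filtration ℝ≥0 mΩ} {i : ℕ}
    (h : ∀ t C, MeasurableSet[𝓕 t] C → AgreesBefore P w u q i t C) (hq : IsTransitionRate 𝓕 q)
    {τ : Ω → ℝ≥0} (hτ : ∀ s, MeasurableSet[𝓕 s] {ω | τ ω ≤ s})
    (hτζ : ∀ ω, (τ ω : WithTop ℝ≥0) < explosionTime q ω) :
    ∃ T : Ω → ℝ≥0∞, Measurable[history w u i] T ∧ ∀ᵐ ω ∂P,
      min (T ω) (ENNReal.ofReal (poissonPoint w i ω)) =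
        min (cumRate q (τ ω) ω) (ENNReal.ofReal (poissonPoint w i ω)) := by
  let d := TopologicalSpace.denseSeq ℝ≥0
  have h1 : ∀ k, ∃ g : Ω → ℝ≥0∞, Measurable[history w u i] g ∧
      ∀ᵐ ω ∂P, ω ∈ beforeJump w q i (d k) → cumRate q (d k) ω = g ω := fun k => by
    obtain ⟨A, hA, hA'⟩ := exists_measurable_eq_cumRate hq.progressive (d k)
    obtain ⟨g, hg, hg'⟩ := exists_measurable_agrees (h (d k)) hA
    refine ⟨g, hg, ?_⟩
    filter_upwards [hg'] with ω hω hU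
    rw [← hω hU, hA' ω hU.1]
  choose g hg hg' using h1
  have h2 : ∀ k, AgreesBefore P w u q i (d k) {ω | τ ω ≤ d k} := fun k =>
    h _ _ (hτ (d k))
  choose C hC hC' using h2
  -- `G k` is the event `d k < τ`, as far as it can be told from the first `i` pairs.
  let G : ℕ → Set Ω := fun k => {ω | ∀ l, d l ≤ d k → ω ∉ C l}
  have hG : ∀ k, MeasurableSet[history w u i] (G k) := fun k => by
    have : G k = ⋂ l, {ω | d l ≤ d k → ω ∉ C l} := by ext; simp [G]
    rw [this]
    refine MeasurableSet.iInter fun l => ?_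
    by_cases hl : d l ≤ d k
    · simpa only [hl, forall_const] using! (hC l).compl
    · simp [hl]
  refine ⟨fun ω => ⨆ k, (G k).indicator (g k) ω, .iSup fun k => (hg k).indicator (hG k), ?_⟩
  filter_upwards [ae_all_iff.2 hg', ae_all_iff.2 hC'] with ω h3 h4
  rcases lt_or_ge (cumRate q (τ ω) ω) (ENNReal.ofReal (poissonPoint w i ω)) with hlt | hge
  · congr 1
    have hU : ω ∈ beforeJump w q i (τ ω) := ⟨hτζ ω, hlt⟩
    apply le_antisymm
    · refine iSup_le fun k => Set.indicator_apply_le' (fun hk => ?_) fun _ => zero_le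
      have hkτ : d k ≤ τ ω := by
        by_contra! hkτ
        obtain ⟨t', ht1, ht2, ht3⟩ := exists_gt_cumRate_lt (hτζ ω) hlt
        obtain ⟨_, ⟨l, rfl⟩, hl⟩ :=
          (TopologicalSpace.denseRange_denseSeq ℝ≥0).exists_between (lt_min ht1 hkτ)
        refine hk l (hl.2.le.trans (min_le_right _ _)) ?_
        exact (h4 l (beforeJump_anti (hl.2.le.trans (min_le_left _ _)) ⟨ht2, ht3⟩)).1 hl.1.le
      rw [← h3 k (beforeJump_anti hkτ hU)]
      exact cumRate_mono hkτ
    · refine le_of_forall_lt fun b hb => ?_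
      obtain ⟨k, hk, hk'⟩ := exists_denseSeq_lt_cumRate (hτζ ω) hb
      have hkG : ω ∈ G k := fun l hl hlC =>
        absurd ((h4 l (beforeJump_anti (hl.trans hk.le) hU)).2 hlC) (not_le.2 (hl.trans_lt hk))
      refine hk'.trans_le (le_trans ?_ (le_iSup _ k))
      rw [Set.indicator_of_mem hkG, ← h3 k (beforeJump_anti hk.le hU)]
  · rw [min_eq_right hge, min_eq_right]
    refine le_of_forall_lt fun b hb => ?_
    obtain ⟨k, hk, hk', hk''⟩ := ofReal_poissonPoint_le_iSup (hτζ ω) hge hb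
    have hU : ∀ l, d l ≤ d k → ω ∈ beforeJump w q i (d l) := fun l hl =>
      ⟨(WithTop.coe_lt_coe.2 (hl.trans_lt hk)).trans (hτζ ω), hk'' _ hl⟩
    have hkG : ω ∈ G k := fun l hl hlC =>
      absurd ((h4 l (hU l hl)).2 hlC) (not_le.2 (hl.trans_lt hk))
    refine hk'.trans_le (le_trans ?_ (le_iSup _ k))
    rw [Set.indicator_of_mem hkG, ← h3 k (hU k le_rfl)]

end History

/-! ### The exponential law -/

theorem expMeasure_one_Ioi {t : ℝ} (ht : 0 ≤ t) :
    expMeasure 1 (Set.Ioi t) = exponentialPDF 1 t := by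
  have := isProbabilityMeasure_expMeasure (r := 1) one_pos
  have h1 : (expMeasure 1).real (Set.Iic t) = 1 - Real.exp (-t) := by
    rw [← cdf_eq_real, cdf_expMeasure_eq one_pos]
    simp [ht]
  rw [← Set.compl_Iic, ← ofReal_measureReal, probReal_compl_eq_one_sub measurableSet_Iic, h1,
    exponentialPDF_of_nonneg ht]
  simp

theorem expMeasure_one_apply {s : Set ℝ} (hs : MeasurableSet s) :
    expMeasure 1 s = ∫⁻ t in s, exponentialPDF 1 t :=
  withDensity_apply _ hs

/-- The compensator of the jump at an exponential time: as the density of the law at `x` is the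
probability of exceeding `x`, the expectation of `min x y` is the probability of `x ≤ y`. -/
theorem lintegral_min_expMeasure_one (y : ℝ≥0∞) :
    ∫⁻ x, min (ENNReal.ofReal x) y ∂(expMeasure 1) = expMeasure 1 {x | ENNReal.ofReal x ≤ y} := by
  have := isProbabilityMeasure_expMeasure (r := 1) one_pos
  induction y using ENNReal.recTopCoe with
  | top =>
    simp only [le_top, inf_of_le_left]
    rw [lintegral_eq_lintegral_meas_lt _ (ae_pos_expMeasure_one.mono fun _ h => le_of_lt h)
      aemeasurable_id]
    rw [setLIntegral_congr_fun measurableSet_Ioi (f := fun t => expMeasure 1 {a : ℝ | t < a})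
      (g := exponentialPDF 1)
      (fun t (ht : 0 < t) => expMeasure_one_Ioi ht.le), ← expMeasure_one_apply measurableSet_Ioi]
    refine measure_congr ?_
    filter_upwards [ae_pos_expMeasure_one] with x hx
    simp only [eq_iff_iff]
    exact ⟨fun _ => trivial, fun _ => hx⟩
  | coe b =>
    have h1 : ∀ x : ℝ, min (ENNReal.ofReal x) (b : ℝ≥0∞) = ENNReal.ofReal (min x b) := fun x => by
      rw [ENNReal.ofReal_min, ENNReal.ofReal_coe_nnreal]
    simp_rw [h1]
    rw [lintegral_eq_lintegral_meas_lt (f := fun x : ℝ => min x (b : ℝ)) _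
      (ae_pos_expMeasure_one.mono fun _ h => le_min (le_of_lt h) b.2)
      (by fun_prop)]
    have h2 : ∀ t ∈ Set.Ioi (0 : ℝ), expMeasure 1 {a : ℝ | t < min a b} =
        (Set.Iio (b : ℝ)).indicator (exponentialPDF 1) t := fun t ht => by
      by_cases htb : t < b
      · rw [Set.indicator_of_mem (Set.mem_Iio.2 htb), ← expMeasure_one_Ioi (le_of_lt ht)]
        congr 1
        ext x
        simp [htb]
      · simp [htb]
    rw [setLIntegral_congr_fun measurableSet_Ioi h2, setLIntegral_indicator measurableSet_Iio,
      ← expMeasure_one_apply (measurableSet_Iio.inter measurableSet_Ioi)]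
    have h3 : ∀ᵐ x : ℝ ∂(expMeasure 1), x ≠ b := by
      rw [ae_iff]
      simp only [not_not]
      have : {x : ℝ | x = b} = {(b : ℝ)} := rfl
      rw [this, expMeasure_one_apply (measurableSet_singleton _)]
      simp
    refine measure_congr ?_
    filter_upwards [ae_pos_expMeasure_one, h3] with x hx hxb
    simp only [eq_iff_iff]
    change (x < b ∧ 0 < x) ↔ ENNReal.ofReal x ≤ b
    rw [← ENNReal.ofReal_coe_nnreal, ENNReal.ofReal_le_ofReal_iff b.coe_nonneg]
    exact ⟨fun h => h.1.le, fun h => ⟨lt_of_le_of_ne h hxb, hx⟩⟩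

section Wald

variable {Ω : Type*} [mΩ : MeasurableSpace Ω] {P : Measure Ω} {w : ℕ → Ω → ℝ}
  {u : ℕ → Ω → unitInterval} {q : ℝ≥0 → Ω → ℝ≥0}

theorem IsMarkedPoisson.isProbabilityMeasure (h : IsMarkedPoisson P w u) :
    IsProbabilityMeasure P := by
  have := isProbabilityMeasure_expMeasure (r := 1) one_pos
  refine ⟨?_⟩
  rw [← Set.preimage_univ (f := w 0), ← Measure.map_apply (h.measurable_w 0) MeasurableSet.univ,
    h.law_w]
  exact measure_univ

/-- The Poisson points do not accumulate. -/
theorem IsMarkedPoisson.ae_tendsto_sum (h : IsMarkedPoisson P w u) :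
    ∀ᵐ ω ∂P, Tendsto (fun n => ∑ j ∈ Finset.range n, w j ω) atTop atTop := by
  have := h.isProbabilityMeasure
  have h1 : ∀ i, P (w i ⁻¹' Set.Ioi 1) = exponentialPDF 1 1 := fun i => by
    rw [← Measure.map_apply (h.measurable_w i) measurableSet_Ioi, h.law_w,
      expMeasure_one_Ioi zero_le_one]
  have hw : iIndepFun w P := h.iIndep.comp (fun _ => Prod.fst) fun _ => measurable_fst
  have h2 : iIndepSet (fun i => w i ⁻¹' Set.Ioi 1) P :=
    (iIndepSet_iff_meas_biInter fun i => h.measurable_w i measurableSet_Ioi).2 fun s =>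
      hw.measure_inter_preimage_eq_mul s fun _ _ => measurableSet_Ioi
  have h3 : ∀ᵐ ω ∂P, ∃ᶠ i in atTop, 1 < w i ω := by
    have h4 := measure_limsup_eq_one (fun i => h.measurable_w i measurableSet_Ioi) h2 (by
      simp_rw [h1]
      refine ENNReal.tsum_const_eq_top_of_ne_zero ?_
      simp [exponentialPDF_of_nonneg, Real.exp_pos])
    have h5 : MeasurableSet (limsup (fun i => w i ⁻¹' Set.Ioi 1) atTop) :=
      MeasurableSet.measurableSet_limsup fun i => h.measurable_w i measurableSet_Ioi
    filter_upwards [(prob_compl_eq_zero_iff h5).2 h4] with ω hω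
    simpa [mem_limsup_iff_frequently_mem] using hω
  filter_upwards [h.ae_pos, h3] with ω h4 h5
  rw [← not_summable_iff_tendsto_nat_atTop_of_nonneg fun i => (h4 i).le]
  intro hs
  obtain ⟨i, hi, hi'⟩ := (h5.and_eventually
    (hs.tendsto_atTop_zero.eventually_lt_const one_pos)).exists
  exact lt_asymm hi hi'

/-- A new pair `(w i, u i)` is independent of a budget `Y` depending on the previous pairs. -/
theorem IsMarkedPoisson.measure_le_budget (h : IsMarkedPoisson P w u) (i : ℕ) {Y : Ω → ℝ≥0∞}
    (hY : Measurable[history w u i] Y) {B : Set unitInterval} (hB : MeasurableSet B) :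
    P {ω | ENNReal.ofReal (w i ω) ≤ Y ω ∧ u i ω ∈ B} =
      volume B * ∫⁻ ω, min (ENNReal.ofReal (w i ω)) (Y ω) ∂P := by
  have := h.isProbabilityMeasure
  have := isProbabilityMeasure_expMeasure (r := 1) one_pos
  have hY' : Measurable Y := hY.mono (h.history_le i) le_rfl
  have h1 : IndepFun Y (fun ω => (w i ω, u i ω)) P :=
    indep_of_indep_of_le_left (h.indep_history i) hY.comap_le
  have h2 : P.map (fun ω => (w i ω, u i ω)) = (expMeasure 1).prod volume := by
    rw [(indepFun_iff_map_prod_eq_prod_map_map (h.measurable_w i).aemeasurable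
      (h.measurable_u i).aemeasurable).1 (h.indep_pair i), h.law_w, h.law_u]
  have h3 : P.map (fun ω => (Y ω, (w i ω, u i ω))) =
      (P.map Y).prod ((expMeasure 1).prod volume) := by
    rw [(indepFun_iff_map_prod_eq_prod_map_map hY'.aemeasurable
      (h.measurable_pair i).aemeasurable).1 h1, h2]
  have hm : Measurable fun ω => (Y ω, (w i ω, u i ω)) := hY'.prodMk (h.measurable_pair i)
  have := Measure.isProbabilityMeasure_map (μ := P) hY'.aemeasurable
  have hS : MeasurableSet
      {p : ℝ≥0∞ × (ℝ × unitInterval) | ENNReal.ofReal p.2.1 ≤ p.1 ∧ p.2.2 ∈ B} :=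
    (measurableSet_le (f := fun p : ℝ≥0∞ × (ℝ × unitInterval) => ENNReal.ofReal p.2.1)
      (by fun_prop) measurable_fst).inter ((measurable_snd.comp measurable_snd) hB)
  have h4 : P {ω | ENNReal.ofReal (w i ω) ≤ Y ω ∧ u i ω ∈ B} =
      ∫⁻ y, expMeasure 1 {x | ENNReal.ofReal x ≤ y} * volume B ∂(P.map Y) := by
    have : {ω | ENNReal.ofReal (w i ω) ≤ Y ω ∧ u i ω ∈ B} = (fun ω => (Y ω, (w i ω, u i ω))) ⁻¹'
        {p : ℝ≥0∞ × (ℝ × unitInterval) | ENNReal.ofReal p.2.1 ≤ p.1 ∧ p.2.2 ∈ B} := rfl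
    rw [this, ← Measure.map_apply hm hS, h3, Measure.prod_apply hS]
    refine lintegral_congr fun y => ?_
    rw [← Measure.prod_prod]
    rfl
  have h5 : ∫⁻ ω, min (ENNReal.ofReal (w i ω)) (Y ω) ∂P =
      ∫⁻ y, ∫⁻ x, min (ENNReal.ofReal x) y ∂(expMeasure 1) ∂(P.map Y) := by
    have hf : Measurable fun p : ℝ≥0∞ × (ℝ × unitInterval) => min (ENNReal.ofReal p.2.1) p.1 := by
      fun_prop
    rw [← lintegral_map (f := fun p : ℝ≥0∞ × (ℝ × unitInterval) =>
      min (ENNReal.ofReal p.2.1) p.1) hf hm, h3, lintegral_prod _ hf.aemeasurable]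
    refine lintegral_congr fun y => ?_
    rw [lintegral_prod _ (by fun_prop)]
    simp
  rw [h4, h5, lintegral_mul_const', mul_comm]
  · simp_rw [lintegral_min_expMeasure_one]
  · exact measure_ne_top _ _

theorem min_add_tsub_min {T a b : ℝ≥0∞} (ha : a ≠ ∞) :
    min T (a + b) - min T a = min b (T - a) := by
  rcases le_total T a with h | h
  · rw [min_eq_left h, min_eq_left (h.trans le_self_add), tsub_self, tsub_eq_zero_of_le h]
    simp
  · rw [min_eq_right h]
    obtain ⟨c, rfl⟩ := exists_add_of_le h
    rw [← add_min, ENNReal.add_sub_cancel_left ha, ENNReal.add_sub_cancel_left ha, min_comm]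

theorem add_le_iff_le_tsub {T a b : ℝ≥0∞} (ha : a ≠ ∞) (hb : 0 < b) :
    a + b ≤ T ↔ b ≤ T - a := by
  rcases le_total a T with h | h
  · exact (ENNReal.cancel_of_ne ha).le_tsub_iff_left h |>.symm
  · rw [tsub_eq_zero_of_le h]
    constructor
    · intro h'
      have : a + b ≤ a + 0 := by simpa using h'.trans h
      simpa using (ENNReal.add_le_add_iff_left ha).1 this
    · intro h'
      exact absurd hb (not_lt.2 h')

/-- Wald's identity for the marked jumps up to a stopping time `τ < ζ`. -/
theorem tsum_measure_jumpTime_le (hwu : IsMarkedPoisson P w u)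
    (hq : Measurable (Function.uncurry q))
    (hrate : IsTransitionRate (jumpFiltration hwu.measurable_w hwu.measurable_u hq) q)
    {τ : Ω → ℝ≥0} (hτ : ∀ s, MeasurableSet[jumpFiltration hwu.measurable_w hwu.measurable_u hq s]
      {ω | τ ω ≤ s})
    (hτζ : ∀ ω, (τ ω : WithTop ℝ≥0) < explosionTime q ω)
    {B : Set unitInterval} (hB : MeasurableSet B) :
    ∑' i, P {ω | jumpTime w q i ω ≤ τ ω ∧ u i ω ∈ B} =
      volume B * ∫⁻ ω, cumRate q (τ ω) ω ∂P := by
  have := hwu.isProbabilityMeasure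
  let s : ℕ → Ω → ℝ≥0∞ := fun n ω => ENNReal.ofReal (∑ j ∈ Finset.range n, w j ω)
  let A : Ω → ℝ≥0∞ := fun ω => cumRate q (τ ω) ω
  -- Here `s i` is the point before the `i`-th one, with `s 0 = 0`. Each jump contributes the growth
  -- of the cumulative rate, capped at `s i` and `s (i + 1)`; the sum over `i` telescopes.
  have hstep : ∀ i, P {ω | jumpTime w q i ω ≤ τ ω ∧ u i ω ∈ B} =
      volume B * ∫⁻ ω, (min (A ω) (s (i + 1) ω) - min (A ω) (s i ω)) ∂P ∧
      AEMeasurable (fun ω => min (A ω) (s (i + 1) ω) - min (A ω) (s i ω)) P := by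
    intro i
    obtain ⟨T, hT, hT'⟩ := exists_measurable_min_cumRate (i := i)
      (fun _ _ hC => agreesBefore hwu hq hrate i hC) hrate hτ hτζ
    have hs : Measurable[history w u i] (s i) := by
      refine Measurable.ennreal_ofReal (Finset.measurable_sum _ fun k hk => ?_)
      exact measurable_fst.comp (measurable_pair_history (Finset.mem_range.1 hk))
    have h1 : ∀ᵐ ω ∂P, 0 < w i ω ∧ s (i + 1) ω = s i ω + ENNReal.ofReal (w i ω) ∧
        min (T ω) (s (i + 1) ω) = min (A ω) (s (i + 1) ω) := by
      filter_upwards [hwu.ae_pos, hT'] with ω h1 h2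
      refine ⟨h1 i, ?_, h2⟩
      simp only [s, Finset.sum_range_succ]
      rw [ENNReal.ofReal_add (Finset.sum_nonneg fun j _ => (h1 j).le) (h1 i).le]
    have h2 : ∀ᵐ ω ∂P, min (A ω) (s (i + 1) ω) - min (A ω) (s i ω) =
        min (ENNReal.ofReal (w i ω)) (T ω - s i ω) := by
      filter_upwards [h1] with ω h1
      have h3 : min (A ω) (s i ω) = min (T ω) (s i ω) := by
        have h4 : min (s (i + 1) ω) (s i ω) = s i ω := by rw [h1.2.1]; simp
        rw [← h4, ← min_assoc, ← min_assoc, h1.2.2]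
      rw [h3, ← h1.2.2, h1.2.1, min_add_tsub_min ENNReal.ofReal_ne_top]
    constructor
    · rw [lintegral_congr_ae h2,
        ← hwu.measure_le_budget i (Y := fun ω => T ω - s i ω) (hT.sub hs) hB]
      refine measure_congr ?_
      filter_upwards [h1] with ω h1
      simp only [eq_iff_iff]
      change jumpTime w q i ω ≤ τ ω ∧ u i ω ∈ B ↔ ENNReal.ofReal (w i ω) ≤ T ω - s i ω ∧ u i ω ∈ B
      rw [jumpTime_le_iff_le_cumRate (hτζ ω)]
      change s (i + 1) ω ≤ A ω ∧ _ ↔ _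
      rw [← min_eq_right_iff, ← h1.2.2, min_eq_right_iff, h1.2.1,
        add_le_iff_le_tsub ENNReal.ofReal_ne_top (by simpa using h1.1)]
    · refine AEMeasurable.congr ?_ (h2.mono fun _ h => h.symm)
      exact ((hwu.measurable_w i).ennreal_ofReal.min
        ((hT.sub hs).mono (hwu.history_le i) le_rfl)).aemeasurable
  simp_rw [fun i => (hstep i).1]
  rw [ENNReal.tsum_mul_left, ← lintegral_tsum fun i => (hstep i).2]
  congr 1
  refine lintegral_congr_ae ?_
  filter_upwards [hwu.ae_pos, hwu.ae_tendsto_sum] with ω h1 h2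
  have hmono : Monotone fun n => min (A ω) (s n ω) := monotone_nat_of_le_succ fun n =>
    min_le_min le_rfl (ENNReal.ofReal_le_ofReal (by
      rw [Finset.sum_range_succ]; linarith [h1 n]))
  have hAfin : A ω ≠ ∞ := (cumRate_lt_top (hτζ ω)).ne
  have h3 : ∀ n, ∑ i ∈ Finset.range n, (min (A ω) (s (i + 1) ω) - min (A ω) (s i ω)) =
      min (A ω) (s n ω) := fun n => by
    induction n with
    | zero => simp [s]
    | succ n ih => rw [Finset.sum_range_succ, ih, add_tsub_cancel_of_le (hmono (Nat.le_succ n))]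
  refine HasSum.tsum_eq ((ENNReal.summable.hasSum_iff_tendsto_nat).2 ?_)
  simp_rw [h3]
  have h4 : Tendsto (fun n => s n ω) atTop (𝓝 ∞) := ENNReal.tendsto_ofReal_atTop.comp h2
  simpa using (tendsto_const_nhds (x := A ω)).min h4

end Wald

/-! ### The compensator of the jump measure on the predictable σ-algebra -/

section Compensator

variable {Ω : Type*} {w : ℕ → Ω → ℝ} {u : ℕ → Ω → unitInterval} {q : ℝ≥0 → Ω → ℝ≥0}

theorem jumpTime_untopD_le_iff {i : ℕ} {ω : Ω} {s : ℝ≥0} (h : jumpTime w q i ω ≠ ⊤) :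
    (jumpTime w q i ω).untopD 0 ≤ s ↔ jumpTime w q i ω ≤ s := by
  obtain ⟨r, hr⟩ := WithTop.ne_top_iff_exists.1 h
  rw [← hr, WithTop.untopD_coe, WithTop.coe_le_coe]

theorem cumRate_eq_add {s t : ℝ≥0} (h : s ≤ t) (ω : Ω) :
    cumRate q t ω = cumRate q s ω + ∫⁻ r in Set.Ioc s t, (q r ω : ℝ≥0∞) ∂leb := by
  rw [cumRate, ← Set.Iic_union_Ioc_eq_Iic h, lintegral_union measurableSet_Ioc]
  · rfl
  · rw [Set.disjoint_left]
    intro x hx hx'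
    exact absurd hx'.1 (not_lt.2 hx)

variable [mΩ : MeasurableSpace Ω] {P : Measure Ω} {τ : Ω → ℝ≥0}

/-- The point in `([0, ∞) × Ω) × [0, 1]` at which the `i`-th jump evaluates a process. The time `0`
stands for an infinite jump time. -/
noncomputable def jumpPoint (w : ℕ → Ω → ℝ) (u : ℕ → Ω → unitInterval) (q : ℝ≥0 → Ω → ℝ≥0)
    (i : ℕ) (ω : Ω) : (ℝ≥0 × Ω) × unitInterval :=
  (((jumpTime w q i ω).untopD 0, ω), u i ω)

/-- The expected number of jumps up to `τ` in a set of times, outcomes and marks. -/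
noncomputable def jumpMeasure (P : Measure Ω) (w : ℕ → Ω → ℝ) (u : ℕ → Ω → unitInterval)
    (q : ℝ≥0 → Ω → ℝ≥0) (τ : Ω → ℝ≥0) : Measure ((ℝ≥0 × Ω) × unitInterval) :=
  Measure.sum fun i => (P.restrict {ω | jumpTime w q i ω ≤ τ ω}).map (jumpPoint w u q i)

/-- The measure `1_{t ≤ τ} q_t dt dP` on `[0, ∞) × Ω`. -/
noncomputable def clockMeasure (P : Measure Ω) (q : ℝ≥0 → Ω → ℝ≥0) (τ : Ω → ℝ≥0) :
    Measure (ℝ≥0 × Ω) :=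
  (leb.prod P).withDensity ({p : ℝ≥0 × Ω | p.1 ≤ τ p.2}.indicator fun p => (q p.1 p.2 : ℝ≥0∞))

theorem measurable_jumpTime_untopD (hw : ∀ i, Measurable (w i))
    (hq : Measurable (Function.uncurry q)) (i : ℕ) :
    Measurable fun ω => (jumpTime w q i ω).untopD 0 := by
  refine measurable_of_Iic fun s => ?_
  have h1 : (fun ω => (jumpTime w q i ω).untopD 0) ⁻¹' Set.Iic s =
      {ω | jumpTime w q i ω ≤ s} ∪ ⋂ n : ℕ, {ω | jumpTime w q i ω ≤ (n : ℝ≥0)}ᶜ := by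
    ext ω
    simp only [Set.mem_preimage, Set.mem_Iic, Set.mem_union, Set.mem_iInter, Set.mem_compl_iff,
      Set.mem_ofPred_eq, not_le]
    rcases eq_or_ne (jumpTime w q i ω) ⊤ with h | h
    · rw [h]
      simp only [WithTop.untopD_top, zero_le, true_iff]
      exact Or.inr fun n => WithTop.coe_lt_top _
    · rw [jumpTime_untopD_le_iff h]
      refine ⟨Or.inl, fun h' => h'.resolve_right fun h' => ?_⟩
      obtain ⟨r, hr⟩ := WithTop.ne_top_iff_exists.1 h
      obtain ⟨n, hn⟩ := exists_nat_ge r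
      have := h' n
      rw [← hr, WithTop.coe_lt_coe] at this
      exact absurd hn (not_le.2 this)
  rw [h1]
  exact (measurableSet_jumpTime_le hw hq i s).union
    (MeasurableSet.iInter fun n => (measurableSet_jumpTime_le hw hq i n).compl)

theorem measurable_jumpPoint (hwu : IsMarkedPoisson P w u)
    (hq : Measurable (Function.uncurry q)) (i : ℕ) : Measurable (jumpPoint w u q i) :=
  ((measurable_jumpTime_untopD hwu.measurable_w hq i).prodMk measurable_id).prodMk
    (hwu.measurable_u i)

theorem measurableSet_jumpTime_le_stopping (hwu : IsMarkedPoisson P w u)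
    (hq : Measurable (Function.uncurry q)) (hτ : Measurable τ) (i : ℕ) :
    MeasurableSet {ω | jumpTime w q i ω ≤ τ ω} := by
  have h1 : {ω | jumpTime w q i ω ≤ τ ω} = {ω | (jumpTime w q i ω).untopD 0 ≤ τ ω} ∩
      ⋃ n : ℕ, {ω | jumpTime w q i ω ≤ (n : ℝ≥0)} := by
    ext ω
    simp only [Set.mem_inter_iff, Set.mem_iUnion, Set.mem_ofPred_eq]
    constructor
    · intro h
      have h2 := ne_top_of_le_ne_top WithTop.coe_ne_top h
      obtain ⟨n, hn⟩ := exists_nat_ge (τ ω)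
      exact ⟨(jumpTime_untopD_le_iff h2).2 h, n, h.trans (WithTop.coe_le_coe.2 hn)⟩
    · rintro ⟨h, n, hn⟩
      exact (jumpTime_untopD_le_iff (ne_top_of_le_ne_top WithTop.coe_ne_top hn)).1 h
  rw [h1]
  exact (measurableSet_le (measurable_jumpTime_untopD hwu.measurable_w hq i) hτ).inter
    (MeasurableSet.iUnion fun n => measurableSet_jumpTime_le hwu.measurable_w hq i n)

theorem jumpMeasure_apply (hwu : IsMarkedPoisson P w u)
    (hq : Measurable (Function.uncurry q)) {S : Set ((ℝ≥0 × Ω) × unitInterval)}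
    (hS : MeasurableSet S) :
    jumpMeasure P w u q τ S =
      ∑' i, P {ω | jumpTime w q i ω ≤ τ ω ∧ jumpPoint w u q i ω ∈ S} := by
  rw [jumpMeasure, Measure.sum_apply _ hS]
  congr 1
  ext i
  rw [Measure.map_apply (measurable_jumpPoint hwu hq i) hS, Measure.restrict_apply
    (measurable_jumpPoint hwu hq i hS)]
  congr 1
  ext ω
  simp [and_comm]

theorem measurableSet_le_stopping (hτ : Measurable τ) :
    MeasurableSet {p : ℝ≥0 × Ω | p.1 ≤ τ p.2} :=
  measurableSet_le measurable_fst (hτ.comp measurable_snd)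

theorem measurable_rate (hq : Measurable (Function.uncurry q)) :
    Measurable fun p : ℝ≥0 × Ω => (q p.1 p.2 : ℝ≥0∞) :=
  measurable_coe_nnreal_ennreal.comp hq

theorem clockMeasure_Ioi_prod [SFinite P] (hq : Measurable (Function.uncurry q))
    (hτ : Measurable τ) (s : ℝ≥0) {C : Set Ω} (hC : MeasurableSet C) :
    clockMeasure P q τ (Set.Ioi s ×ˢ C) =
      ∫⁻ ω in C, ∫⁻ r in Set.Ioc s (τ ω), (q r ω : ℝ≥0∞) ∂leb ∂P := by
  have hm := (measurable_rate hq).indicator (measurableSet_le_stopping hτ)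
  rw [clockMeasure, withDensity_apply _ (measurableSet_Ioi.prod hC), ← Measure.prod_restrict,
    lintegral_prod_symm _ hm.aemeasurable]
  refine lintegral_congr fun ω => ?_
  have : (fun r => {p : ℝ≥0 × Ω | p.1 ≤ τ p.2}.indicator (fun p => (q p.1 p.2 : ℝ≥0∞)) (r, ω)) =
      (Set.Iic (τ ω)).indicator fun r => (q r ω : ℝ≥0∞) := rfl
  rw [this, lintegral_indicator measurableSet_Iic, Measure.restrict_restrict measurableSet_Iic,
    Set.inter_comm, Set.Ioi_inter_Iic]

theorem clockMeasure_univ_prod [SFinite P] (hq : Measurable (Function.uncurry q))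
    (hτ : Measurable τ) {C : Set Ω} (hC : MeasurableSet C) :
    clockMeasure P q τ (Set.univ ×ˢ C) = ∫⁻ ω in C, cumRate q (τ ω) ω ∂P := by
  have hm := (measurable_rate hq).indicator (measurableSet_le_stopping hτ)
  rw [clockMeasure, withDensity_apply _ (MeasurableSet.univ.prod hC), ← Measure.prod_restrict,
    lintegral_prod_symm _ hm.aemeasurable]
  refine lintegral_congr fun ω => ?_
  have : (fun r => {p : ℝ≥0 × Ω | p.1 ≤ τ p.2}.indicator (fun p => (q p.1 p.2 : ℝ≥0∞)) (r, ω)) =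
      (Set.Iic (τ ω)).indicator fun r => (q r ω : ℝ≥0∞) := rfl
  rw [this, lintegral_indicator measurableSet_Iic, Measure.restrict_univ, cumRate]

theorem predictable_le (𝓕 : Filtration ℝ≥0 mΩ) : 𝓕.predictable ≤ Prod.instMeasurableSpace :=
  measurableSpace_le_predictable_of_measurableSet
    (fun _ hA => (measurableSet_singleton _).prod (𝓕.le _ _ hA))
    (fun _ _ hA => measurableSet_Ioi.prod (𝓕.le _ _ hA))

theorem predictable_prod_le (𝓕 : Filtration ℝ≥0 mΩ) :
    𝓕.predictable.prod (inferInstance : MeasurableSpace unitInterval) ≤ Prod.instMeasurableSpace :=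
  sup_le_sup (MeasurableSpace.comap_mono (predictable_le 𝓕)) le_rfl

theorem isPiSystem_predictable (𝓕 : Filtration ℝ≥0 mΩ) :
    IsPiSystem ({s | ∃ A, MeasurableSet[𝓕 ⊥] A ∧ s = {⊥} ×ˢ A} ∪
      {s | ∃ i A, MeasurableSet[𝓕 i] A ∧ s = Set.Ioi i ×ˢ A}) := by
  rintro _ (⟨A, hA, rfl⟩ | ⟨i, A, hA, rfl⟩) _ (⟨B, hB, rfl⟩ | ⟨j, B, hB, rfl⟩) hne
  · exact Or.inl ⟨A ∩ B, hA.inter hB, by rw [Set.prod_inter_prod, Set.inter_self]⟩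
  · exact absurd hne (by simp [Set.prod_inter_prod])
  · exact absurd hne (by simp [Set.prod_inter_prod])
  · refine Or.inr ⟨max i j, A ∩ B, ?_, by rw [Set.prod_inter_prod, Set.Ioi_inter_Ioi]⟩
    exact (𝓕.mono (le_max_left i j) _ hA).inter (𝓕.mono (le_max_right i j) _ hB)

theorem measurable_of_stopping {𝓕 : Filtration ℝ≥0 mΩ}
    (hτ : ∀ s, MeasurableSet[𝓕 s] {ω | τ ω ≤ s}) : Measurable τ :=
  measurable_of_Iic fun s => 𝓕.le s _ (hτ s)

/-- On `(s, ∞) × C` with `C` known at time `s`, the identity is the difference of Wald's identities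
for two stopping times: the one that equals `τ` on `C` and `min τ s` elsewhere, and `min τ s`. -/
theorem jumpMeasure_Ioi_prod (hwu : IsMarkedPoisson P w u)
    (hq : Measurable (Function.uncurry q))
    (hrate : IsTransitionRate (jumpFiltration hwu.measurable_w hwu.measurable_u hq) q)
    (hτ : ∀ s, MeasurableSet[jumpFiltration hwu.measurable_w hwu.measurable_u hq s]
      {ω | τ ω ≤ s})
    (hτζ : ∀ ω, (τ ω : WithTop ℝ≥0) < explosionTime q ω)
    (hfin : ∫⁻ ω, cumRate q (τ ω) ω ∂P ≠ ∞)
    {s : ℝ≥0} {C : Set Ω}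
    (hC : MeasurableSet[jumpFiltration hwu.measurable_w hwu.measurable_u hq s] C)
    {B : Set unitInterval} (hB : MeasurableSet B) :
    jumpMeasure P w u q τ ((Set.Ioi s ×ˢ C) ×ˢ B) =
      clockMeasure P q τ (Set.Ioi s ×ˢ C) * volume B := by
  classical
  have := hwu.isProbabilityMeasure
  set 𝓕 := jumpFiltration hwu.measurable_w hwu.measurable_u hq with h𝓕
  have hCm : MeasurableSet C := 𝓕.le _ _ hC
  have hτm := measurable_of_stopping hτ
  let τ₀ : Ω → ℝ≥0 := fun ω => min (τ ω) s
  let τ₁ : Ω → ℝ≥0 := fun ω => if ω ∈ C then τ ω else min (τ ω) s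
  have hτ₀ : ∀ r, MeasurableSet[𝓕 r] {ω | τ₀ ω ≤ r} := fun r => by
    by_cases hr : s ≤ r
    · simp [τ₀, hr]
    · simpa [τ₀, hr] using! hτ r
  have hτ₁ : ∀ r, MeasurableSet[𝓕 r] {ω | τ₁ ω ≤ r} := fun r => by
    by_cases hr : s ≤ r
    · have : {ω | τ₁ ω ≤ r} = Cᶜ ∪ {ω | τ ω ≤ r} := by
        ext ω
        by_cases hω : ω ∈ C <;> simp [τ₁, hω, hr]
      rw [this]
      exact (𝓕.mono hr _ hC).compl.union (hτ r)
    · have : {ω | τ₁ ω ≤ r} = {ω | τ ω ≤ r} := by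
        ext ω
        by_cases hω : ω ∈ C <;> simp [τ₁, hω, hr]
      rw [this]
      exact hτ r
  have hle₀ : ∀ ω, τ₀ ω ≤ τ ω := fun ω => min_le_left _ _
  have hle₁ : ∀ ω, τ₁ ω ≤ τ ω := fun ω => by
    by_cases hω : ω ∈ C <;> simp [τ₁, hω]
  have hζ₀ : ∀ ω, (τ₀ ω : WithTop ℝ≥0) < explosionTime q ω := fun ω =>
    (WithTop.coe_le_coe.2 (hle₀ ω)).trans_lt (hτζ ω)
  have hζ₁ : ∀ ω, (τ₁ ω : WithTop ℝ≥0) < explosionTime q ω := fun ω =>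
    (WithTop.coe_le_coe.2 (hle₁ ω)).trans_lt (hτζ ω)
  have hW₀ := tsum_measure_jumpTime_le hwu hq hrate hτ₀ hζ₀ hB
  have hW₁ := tsum_measure_jumpTime_le hwu hq hrate hτ₁ hζ₁ hB
  have hS : MeasurableSet ((Set.Ioi s ×ˢ C) ×ˢ B) := (measurableSet_Ioi.prod hCm).prod hB
  have hadd : ∑' i, P {ω | jumpTime w q i ω ≤ τ₁ ω ∧ u i ω ∈ B} =
      ∑' i, P {ω | jumpTime w q i ω ≤ τ₀ ω ∧ u i ω ∈ B} +
      jumpMeasure P w u q τ ((Set.Ioi s ×ˢ C) ×ˢ B) := by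
    rw [jumpMeasure_apply hwu hq hS, ← ENNReal.tsum_add]
    congr 1
    ext i
    rw [← measure_union]
    · congr 1
      ext ω
      simp only [Set.mem_union, Set.mem_ofPred_eq, jumpPoint, Set.mem_prod, Set.mem_Ioi]
      rcases eq_or_ne (jumpTime w q i ω) ⊤ with h | h
      · have htop : ∀ r : ℝ≥0, ¬ (⊤ : WithTop ℝ≥0) ≤ r := fun r => not_le.2 (WithTop.coe_lt_top r)
        simp only [h, htop, false_and, or_false]
      · obtain ⟨r, hr⟩ := WithTop.ne_top_iff_exists.1 h
        rw [← hr]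
        simp only [WithTop.coe_le_coe, WithTop.untopD_coe, τ₁, τ₀]
        by_cases hω : ω ∈ C
        · simp only [hω, if_true, le_min_iff]
          rcases le_or_gt r s with hrs | hrs
          · simp [hrs, not_lt.2 hrs]
          · simp [hrs, not_le.2 hrs]
        · simp [hω]
    · rw [Set.disjoint_left]
      rintro ω ⟨h1, -⟩ ⟨-, h2⟩
      simp only [jumpPoint, Set.mem_prod, Set.mem_Ioi] at h2
      have h3 := (jumpTime_untopD_le_iff (ne_top_of_le_ne_top WithTop.coe_ne_top h1)).2 h1
      exact absurd (h3.trans (min_le_right _ _)) (not_le.2 h2.1.1)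
    · exact (measurableSet_jumpTime_le_stopping hwu hq hτm i).inter
        (measurable_jumpPoint hwu hq i hS)
  have hadd' : ∫⁻ ω, cumRate q (τ₁ ω) ω ∂P = ∫⁻ ω, cumRate q (τ₀ ω) ω ∂P +
      clockMeasure P q τ (Set.Ioi s ×ˢ C) := by
    rw [clockMeasure_Ioi_prod hq hτm s hCm, ← lintegral_indicator hCm, ← lintegral_add_left]
    · refine lintegral_congr fun ω => ?_
      by_cases hω : ω ∈ C
      · simp only [hω, Set.indicator_of_mem, τ₁, τ₀, if_true]
        rw [cumRate_eq_add (min_le_left (τ ω) s)]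
        congr 2
        rcases le_total (τ ω) s with h | h
        · simp [h]
        · simp [h]
      · simp [hω, τ₁, τ₀]
    · have h1 : (fun ω => cumRate q (τ₀ ω) ω) = fun ω =>
          ∫⁻ r, {p : ℝ≥0 × Ω | p.1 ≤ τ₀ p.2}.indicator (fun p => (q p.1 p.2 : ℝ≥0∞)) (r, ω)
            ∂leb := by
        ext ω
        rw [cumRate, ← lintegral_indicator measurableSet_Iic]
        rfl
      rw [h1]
      exact ((measurable_rate hq).indicator
        (measurableSet_le_stopping (measurable_of_stopping hτ₀))).lintegral_prod_left'
  have hfin₀ : volume B * ∫⁻ ω, cumRate q (τ₀ ω) ω ∂P ≠ ∞ :=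
    ENNReal.mul_ne_top (measure_ne_top _ _) (ne_top_of_le_ne_top hfin
      (lintegral_mono fun ω => cumRate_mono (hle₀ ω)))
  rw [hW₀, hW₁, hadd', mul_add] at hadd
  rw [mul_comm]
  exact ((ENNReal.add_right_inj hfin₀).1 hadd).symm

/-- The compensation formula: on predictable sets of times, outcomes and marks, the expected number
of jumps up to `τ` is the integral of the transition rate. -/
theorem trim_jumpMeasure_eq (hwu : IsMarkedPoisson P w u)
    (hq : Measurable (Function.uncurry q))
    (hrate : IsTransitionRate (jumpFiltration hwu.measurable_w hwu.measurable_u hq) q)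
    (hτ : ∀ s, MeasurableSet[jumpFiltration hwu.measurable_w hwu.measurable_u hq s]
      {ω | τ ω ≤ s})
    (hτζ : ∀ ω, (τ ω : WithTop ℝ≥0) < explosionTime q ω)
    (hfin : ∫⁻ ω, cumRate q (τ ω) ω ∂P ≠ ∞) :
    (jumpMeasure P w u q τ).trim
        (predictable_prod_le (jumpFiltration hwu.measurable_w hwu.measurable_u hq)) =
      ((clockMeasure P q τ).prod volume).trim
        (predictable_prod_le (jumpFiltration hwu.measurable_w hwu.measurable_u hq)) := by
  have := hwu.isProbabilityMeasure
  have hτm := measurable_of_stopping hτ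
  set 𝓕 := jumpFiltration hwu.measurable_w hwu.measurable_u hq with h𝓕
  have hclock : IsFiniteMeasure (clockMeasure P q τ) := ⟨by
    rw [← Set.univ_prod_univ, clockMeasure_univ_prod hq hτm MeasurableSet.univ]
    simpa using hfin.lt_top⟩
  have huniv : ∀ {B : Set unitInterval}, MeasurableSet B →
      jumpMeasure P w u q τ (Set.univ ×ˢ B) = clockMeasure P q τ Set.univ * volume B := fun hB => by
    rw [jumpMeasure_apply hwu hq (MeasurableSet.univ.prod hB), ← Set.univ_prod_univ,
      clockMeasure_univ_prod hq hτm MeasurableSet.univ, Measure.restrict_univ, mul_comm,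
      ← tsum_measure_jumpTime_le hwu hq hrate hτ hτζ hB]
    simp [jumpPoint]
  have hjump : IsFiniteMeasure (jumpMeasure P w u q τ) := ⟨by
    rw [← Set.univ_prod_univ, huniv MeasurableSet.univ]
    exact ENNReal.mul_lt_top (measure_lt_top _ _) (measure_lt_top _ _)⟩
  refine @Measure.ext_prod _ _ 𝓕.predictable _ _ _ (isFiniteMeasure_trim _) ?_
  intro S B hS hB
  have hm : ∀ {S}, MeasurableSet[𝓕.predictable] S →
      MeasurableSet[𝓕.predictable.prod inferInstance] (S ×ˢ B) := fun hS =>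
    @MeasurableSet.prod _ _ 𝓕.predictable _ _ _ hS hB
  rw [trim_measurableSet_eq _ (hm hS), trim_measurableSet_eq _ (hm hS), Measure.prod_prod]
  induction S, hS using MeasurableSpace.induction_on_inter (m := 𝓕.predictable) rfl
    (isPiSystem_predictable 𝓕) with
  | empty => simp
  | basic S hS =>
    rcases hS with ⟨A, hA, rfl⟩ | ⟨s, C, hC, rfl⟩
    · have h1 : clockMeasure P q τ ({⊥} ×ˢ A) = 0 :=
        withDensity_absolutelyContinuous _ _ (by
          rw [Measure.prod_prod, leb_singleton, zero_mul])
      have hA' : MeasurableSet A := 𝓕.le _ _ hA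
      rw [h1, zero_mul, jumpMeasure_apply hwu hq
        (((measurableSet_singleton _).prod hA').prod hB)]
      refine ENNReal.tsum_eq_zero.2 fun i => ?_
      refine measure_eq_zero_iff_ae_notMem.2 ?_
      filter_upwards [hwu.ae_pos] with ω hω hmem
      have h2 : (0 : ℝ) < poissonPoint w i ω :=
        Finset.sum_pos (fun j _ => hω j) (by simp)
      have h3 := hmem.1
      have h4 : (jumpTime w q i ω).untopD 0 = 0 := hmem.2.1.1
      have h5 : jumpTime w q i ω ≤ ((0 : ℝ≥0) : WithTop ℝ≥0) :=
        (jumpTime_untopD_le_iff (ne_top_of_le_ne_top WithTop.coe_ne_top h3)).1 h4.le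
      rw [jumpTime_le_iff_le_cumRate ((WithTop.coe_le_coe.2 zero_le).trans_lt (hτζ ω)),
        cumRate_zero] at h5
      exact absurd (ENNReal.ofReal_pos.2 h2) (not_lt.2 h5)
    · exact jumpMeasure_Ioi_prod hwu hq hrate hτ hτζ hfin hC hB
  | compl S hS ih =>
    have h1 : Sᶜ ×ˢ B = (Set.univ ×ˢ B) \ (S ×ˢ B) := by
      ext ⟨x, y⟩
      simp only [Set.mem_prod, Set.mem_compl_iff, Set.mem_sdiff, Set.mem_univ, true_and]
      tauto
    have hS' := predictable_le 𝓕 _ hS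
    rw [h1, measure_sdiff (Set.prod_mono (Set.subset_univ _) le_rfl)
      (hS'.prod hB).nullMeasurableSet (measure_ne_top _ _), huniv hB, ih,
      measure_compl hS' (measure_ne_top _ _), ENNReal.sub_mul]
    exact fun _ _ => measure_ne_top _ _
  | iUnion f hd hf ih =>
    have h1 : (⋃ i, f i) ×ˢ B = ⋃ i, f i ×ˢ B := Set.iUnion_prod_const
    rw [h1, measure_iUnion _ fun i => (predictable_le 𝓕 _ (hf i)).prod hB,
      measure_iUnion hd fun i => predictable_le 𝓕 _ (hf i), ← ENNReal.tsum_mul_right]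
    · exact tsum_congr ih
    · intro i j hij
      exact Set.disjoint_prod.2 (Or.inl (hd hij))

end Compensator

/-! ### Adaptedness of the stopped processes -/

section Adapted

variable {Ω : Type*}

/-- The bounded stopping time `min t τ`, as a finite number. -/
noncomputable def stopAt (τ : Ω → WithTop ℝ≥0) (t : ℝ≥0) (ω : Ω) : ℝ≥0 :=
  (min (t : WithTop ℝ≥0) (τ ω)).untopA

variable {τ : Ω → WithTop ℝ≥0} {s t : ℝ≥0} {ω : Ω}

theorem coe_stopAt (τ : Ω → WithTop ℝ≥0) (t : ℝ≥0) (ω : Ω) :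
    (stopAt τ t ω : WithTop ℝ≥0) = min (t : WithTop ℝ≥0) (τ ω) := by
  obtain ⟨r, hr⟩ := WithTop.ne_top_iff_exists.1
    (ne_top_of_le_ne_top WithTop.coe_ne_top (min_le_left (t : WithTop ℝ≥0) (τ ω)))
  rw [stopAt, ← hr]
  rfl

theorem le_stopAt_iff : s ≤ stopAt τ t ω ↔ s ≤ t ∧ (s : WithTop ℝ≥0) ≤ τ ω := by
  rw [← WithTop.coe_le_coe, coe_stopAt, le_min_iff, WithTop.coe_le_coe]

theorem stopAt_le_iff : stopAt τ t ω ≤ s ↔ t ≤ s ∨ τ ω ≤ s := by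
  rw [← WithTop.coe_le_coe, coe_stopAt, min_le_iff, WithTop.coe_le_coe]

theorem stopAt_le : stopAt τ t ω ≤ t := stopAt_le_iff.2 (Or.inl le_rfl)

theorem coe_stopAt_le : (stopAt τ t ω : WithTop ℝ≥0) ≤ τ ω := by
  rw [coe_stopAt]; exact min_le_right _ _

theorem le_stopAt_iff_of_le (h : s ≤ t) {r : ℝ≥0} :
    r ≤ stopAt τ s ω ↔ r ≤ stopAt τ t ω ∧ r ≤ s := by
  simp only [le_stopAt_iff]
  exact ⟨fun h' => ⟨⟨h'.1.trans h, h'.2⟩, h'.1⟩, fun h' => ⟨h'.2, h'.1.2⟩⟩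

theorem le_coe_stopAt_iff_of_le (h : s ≤ t) {r : WithTop ℝ≥0} :
    r ≤ stopAt τ s ω ↔ r ≤ stopAt τ t ω ∧ r ≤ s := by
  simp only [coe_stopAt, le_min_iff]
  exact ⟨fun h' => ⟨⟨h'.1.trans (WithTop.coe_le_coe.2 h), h'.2⟩, h'.1⟩, fun h' => ⟨h'.2, h'.1.2⟩⟩

theorem stopAt_mono (h : s ≤ t) : stopAt τ s ω ≤ stopAt τ t ω :=
  ((le_stopAt_iff_of_le h).1 le_rfl).1

theorem coe_stopAt_lt {ζ : Ω → WithTop ℝ≥0} (h : ∀ ω, τ ω < ζ ω ∨ ζ ω = ⊤) (t : ℝ≥0) (ω : Ω) :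
    (stopAt τ t ω : WithTop ℝ≥0) < ζ ω := by
  rcases h ω with h | h
  · exact coe_stopAt_le.trans_lt h
  · rw [h]; exact WithTop.coe_lt_top _

theorem stronglyMeasurable_finsum {E : Type*} [NormedAddCommGroup E] {m : MeasurableSpace Ω}
    {g : ℕ → Ω → E} (hg : ∀ i, StronglyMeasurable (g i)) :
    StronglyMeasurable fun ω => ∑ᶠ i, g i ω := by
  classical
  let S : ℕ → Set Ω := fun N => ⋂ i, ⋂ (_ : N ≤ i), {ω | g i ω = 0}
  have hS : ∀ N, MeasurableSet (S N) := fun N =>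
    MeasurableSet.iInter fun i => MeasurableSet.iInter fun _ =>
      (hg i).measurableSet_eq_fun stronglyMeasurable_const
  refine stronglyMeasurable_of_tendsto (f := fun N ω =>
    (S N).indicator (fun ω => ∑ i ∈ Finset.range N, g i ω) ω) atTop
    (fun N => (Finset.stronglyMeasurable_fun_sum _ fun i _ => hg i).indicator (hS N)) ?_
  rw [tendsto_pi_nhds]
  intro ω
  by_cases hfin : (Function.support fun i => g i ω).Finite
  · obtain ⟨N, hN⟩ := hfin.bddAbove
    refine tendsto_const_nhds.congr' ?_
    filter_upwards [eventually_gt_atTop N] with n hn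
    have h1 : ∀ i, n ≤ i → g i ω = 0 := fun i hi => by
      by_contra h
      exact absurd (hN h) (not_le.2 (hn.trans_le hi))
    have h2 : ω ∈ S n := by simpa [S] using h1
    rw [Set.indicator_of_mem h2]
    refine finsum_eq_sum_of_support_subset _ fun i hi => ?_
    by_contra h
    exact hi (h1 i (by simpa using h))
  · rw [finsum_of_infinite_support hfin]
    refine tendsto_const_nhds.congr fun N => ?_
    rw [Set.indicator_of_notMem]
    intro hω
    refine hfin ((Finset.range N).finite_toSet.subset fun i hi => ?_)
    by_contra h
    simp only [S, Set.mem_iInter] at hω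
    exact hi (hω i (by simpa using h))

variable [mΩ : MeasurableSpace Ω] {𝓕 : Filtration ℝ≥0 mΩ}

theorem measurableSet_stopAt_le (hτ : IsStoppingTime 𝓕 τ) (t s : ℝ≥0) :
    MeasurableSet[𝓕 s] {ω | stopAt τ t ω ≤ s} := by
  simp only [stopAt_le_iff]
  by_cases h : t ≤ s
  · simp [h]
  · simpa [h] using! hτ s

/-- The stochastic interval `[0, τ]` is predictable. -/
theorem measurableSet_predictable_le (hτ : IsStoppingTime 𝓕 τ) :
    MeasurableSet[𝓕.predictable] {p : ℝ≥0 × Ω | (p.1 : WithTop ℝ≥0) ≤ τ p.2} := by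
  let d := TopologicalSpace.denseSeq ℝ≥0
  have h1 : {p : ℝ≥0 × Ω | (p.1 : WithTop ℝ≥0) ≤ τ p.2} =
      (⋃ k, Set.Ioi (d k) ×ˢ {ω | τ ω ≤ d k})ᶜ := by
    ext ⟨a, ω⟩
    simp only [Set.mem_ofPred_eq, Set.mem_compl_iff, Set.mem_iUnion, Set.mem_prod, Set.mem_Ioi,
      not_exists, not_and]
    constructor
    · intro h k hk hk'
      exact absurd (WithTop.coe_le_coe.1 (h.trans hk')) (not_le.2 hk)
    · intro h
      by_contra! hlt
      obtain ⟨r, hr⟩ := WithTop.ne_top_iff_exists.1 hlt.ne_top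
      rw [← hr, WithTop.coe_lt_coe] at hlt
      obtain ⟨_, ⟨k, rfl⟩, hk⟩ :=
        (TopologicalSpace.denseRange_denseSeq ℝ≥0).exists_between hlt
      exact h k hk.2 (by rw [← hr]; exact WithTop.coe_le_coe.2 hk.1.le)
  rw [h1]
  exact MeasurableSet.compl (MeasurableSet.iUnion fun k =>
    measurableSet_predictable_Ioi_prod (hτ (d k)))

/-- The integral up to `min t τ` of a process that is progressive on `[0, ζ)` is adapted. -/
theorem stronglyMeasurable_setIntegral_stopAt {E : Type*} [NormedAddCommGroup E] [NormedSpace ℝ E]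
    {ζ : Ω → WithTop ℝ≥0} {Y : ℝ≥0 → Ω → E} (hY : IsStronglyProgressive 𝓕 (before ζ Y))
    (hτ : IsStoppingTime 𝓕 τ) (hτζ : ∀ ω, τ ω < ζ ω ∨ ζ ω = ⊤) (t : ℝ≥0) :
    StronglyMeasurable[𝓕 t] fun ω => ∫ s in Set.Iic (stopAt τ t ω), Y s ω ∂leb := by
  have h1 : IsStronglyProgressive 𝓕 fun s ω =>
      {p : ℝ≥0 × Ω | (p.1 : WithTop ℝ≥0) ≤ τ p.2}.indicator
        (fun p => before ζ Y p.1 p.2) (s, ω) := fun t => by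
    have h2 := measurable_inclusion_predictable (i := t) (measurableSet_predictable_le hτ)
    exact (hY t).indicator h2
  have h2 := stronglyMeasurable_setIntegral_of_progressive h1 t
  convert h2 using 2 with ω
  rw [← integral_indicator measurableSet_Iic, ← integral_indicator measurableSet_Iic]
  congr 1
  ext s
  simp only [Set.indicator_apply, Set.mem_Iic, le_stopAt_iff, Set.mem_ofPred_eq]
  by_cases h3 : s ≤ t
  · by_cases h4 : (s : WithTop ℝ≥0) ≤ τ ω
    · have h5 : (s : WithTop ℝ≥0) < ζ ω := by
        rcases hτζ ω with h | h
        · exact h4.trans_lt h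
        · rw [h]; exact WithTop.coe_lt_top _
      simp only [h3, h4, and_self, if_true, before_of_lt h5]
    · rw [if_neg fun h => h4 h.2, if_neg h4]
      simp
  · simp [h3]

variable {P : Measure Ω} {w : ℕ → Ω → ℝ} {u : ℕ → Ω → unitInterval} {q : ℝ≥0 → Ω → ℝ≥0}

theorem measurableSet_jumpFiltration {hw : ∀ i, Measurable (w i)} {hu : ∀ i, Measurable (u i)}
    {hq : Measurable (Function.uncurry q)} {s t : ℝ≥0} (hst : s ≤ t) (i : ℕ)
    {B : Set unitInterval} (hB : MeasurableSet B) :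
    MeasurableSet[jumpFiltration hw hu hq t] {ω | jumpTime w q i ω ≤ s ∧ u i ω ∈ B} :=
  MeasurableSpace.measurableSet_generateFrom ⟨i, s, B, hst, hB, rfl⟩

/-- The value of a predictable function at the `i`-th jump is known at the time of this jump. -/
theorem stronglyMeasurable_indicator_jumpPoint {hw : ∀ i, Measurable (w i)}
    {hu : ∀ i, Measurable (u i)} {hq : Measurable (Function.uncurry q)} {E : Type*}
    [NormedAddCommGroup E] {f : (ℝ≥0 × Ω) × unitInterval → E}
    (hf : StronglyMeasurable[(jumpFiltration hw hu hq).predictable.prod inferInstance] f)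
    (hτ : IsStoppingTime (jumpFiltration hw hu hq) τ) (t : ℝ≥0) (i : ℕ) :
    StronglyMeasurable[jumpFiltration hw hu hq t]
      ({ω | jumpTime w q i ω ≤ stopAt τ t ω}.indicator fun ω => f (jumpPoint w u q i ω)) := by
  classical
  set 𝓕 := jumpFiltration hw hu hq
  have hle : ∀ {s}, s ≤ t → MeasurableSet[𝓕 t] {ω | jumpTime w q i ω ≤ s} := fun hs => by
    simpa using measurableSet_jumpFiltration (hw := hw) (hu := hu) (hq := hq) hs i
      (B := Set.univ) MeasurableSet.univ
  -- Once the `i`-th jump is later than `t`, the jump point is replaced by a fixed one.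
  let r : Ω → ℝ≥0 := fun ω => if jumpTime w q i ω ≤ t then (jumpTime w q i ω).untopD 0 else 0
  let v : Ω → unitInterval := fun ω => if jumpTime w q i ω ≤ t then u i ω else 0
  have hrv : ∀ {ω}, jumpTime w q i ω ≤ t → r ω = (jumpTime w q i ω).untopD 0 ∧ v ω = u i ω :=
    fun h => ⟨if_pos h, if_pos h⟩
  have hrv' : ∀ {ω}, ¬ jumpTime w q i ω ≤ t → r ω = 0 ∧ v ω = 0 :=
    fun h => ⟨if_neg h, if_neg h⟩
  have hrt : ∀ ω, r ω ≤ t := fun ω => by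
    by_cases h : jumpTime w q i ω ≤ t
    · rw [(hrv h).1]
      exact (jumpTime_untopD_le_iff (ne_top_of_le_ne_top WithTop.coe_ne_top h)).2 h
    · rw [(hrv' h).1]
      exact zero_le
  have hr : Measurable[𝓕 t] r := by
    refine measurable_of_Iic (mδ := 𝓕 t) fun s => ?_
    rcases le_or_gt t s with hs | hs
    · have : r ⁻¹' Set.Iic s = Set.univ := Set.eq_univ_of_forall fun ω => (hrt ω).trans hs
      rw [this]
      exact @MeasurableSet.univ _ (𝓕 t)
    · have : r ⁻¹' Set.Iic s = {ω | jumpTime w q i ω ≤ s} ∪ {ω | jumpTime w q i ω ≤ t}ᶜ := by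
        ext ω
        change r ω ≤ s ↔ jumpTime w q i ω ≤ s ∨ ¬ jumpTime w q i ω ≤ t
        by_cases h : jumpTime w q i ω ≤ t
        · rw [(hrv h).1, jumpTime_untopD_le_iff (ne_top_of_le_ne_top WithTop.coe_ne_top h)]
          exact ⟨Or.inl, fun h' => h'.resolve_right (not_not.2 h)⟩
        · rw [(hrv' h).1]
          exact ⟨fun _ => Or.inr h, fun _ => zero_le⟩
      rw [this]
      exact (hle hs.le).union (hle le_rfl).compl
  have hv : Measurable[𝓕 t] v := by
    intro B hB
    have : v ⁻¹' B = {ω | jumpTime w q i ω ≤ t ∧ u i ω ∈ B} ∪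
        ({ω | jumpTime w q i ω ≤ t}ᶜ ∩ {_ω | (0 : unitInterval) ∈ B}) := by
      ext ω
      change v ω ∈ B ↔ (jumpTime w q i ω ≤ t ∧ u i ω ∈ B) ∨ (¬ jumpTime w q i ω ≤ t ∧ _)
      by_cases h : jumpTime w q i ω ≤ t
      · rw [(hrv h).2]
        exact ⟨fun h' => Or.inl ⟨h, h'⟩, fun h' => (h'.resolve_right fun h'' => h''.1 h).2⟩
      · rw [(hrv' h).2]
        exact ⟨fun h' => Or.inr ⟨h, h'⟩, fun h' => (h'.resolve_left fun h'' => h h''.1).2⟩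
    rw [this]
    exact (measurableSet_jumpFiltration le_rfl i hB).union
      ((hle le_rfl).compl.inter (@MeasurableSet.const _ (𝓕 t) _))
  have hΦ₁ : @Measurable _ _ (𝓕 t) 𝓕.predictable fun ω => (r ω, ω) := by
    refine @measurable_generateFrom _ _ (𝓕 t) _ _ ?_
    rintro _ (⟨A, hA, rfl⟩ | ⟨s, A, hA, rfl⟩)
    · have : (fun ω => (r ω, ω)) ⁻¹' ({⊥} ×ˢ A) = r ⁻¹' {⊥} ∩ A := rfl
      rw [this]
      exact (hr (measurableSet_singleton _)).inter (𝓕.mono bot_le _ hA)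
    · have : (fun ω => (r ω, ω)) ⁻¹' (Set.Ioi s ×ˢ A) = r ⁻¹' Set.Ioi s ∩ A := rfl
      rw [this]
      rcases le_total s t with hs | hs
      · exact (hr measurableSet_Ioi).inter (𝓕.mono hs _ hA)
      · have : r ⁻¹' Set.Ioi s = ∅ := by
          ext ω
          simpa using (hrt ω).trans hs
        rw [this, Set.empty_inter]
        exact @MeasurableSet.empty _ (𝓕 t)
  have hΦ : @Measurable _ _ (𝓕 t) (𝓕.predictable.prod inferInstance)
      fun ω => ((r ω, ω), v ω) := @Measurable.prodMk _ (𝓕 t) _ _ 𝓕.predictable _ _ _ hΦ₁ hv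
  have hset : {ω | jumpTime w q i ω ≤ stopAt τ t ω} = {ω | jumpTime w q i ω ≤ t} ∩
      (fun ω => (r ω, ω)) ⁻¹' {p : ℝ≥0 × Ω | (p.1 : WithTop ℝ≥0) ≤ τ p.2} := by
    ext ω
    simp only [Set.mem_ofPred_eq, coe_stopAt, le_min_iff, Set.mem_inter_iff, Set.mem_preimage]
    refine and_congr_right fun h => ?_
    obtain ⟨a, ha⟩ := WithTop.ne_top_iff_exists.1 (ne_top_of_le_ne_top WithTop.coe_ne_top h)
    rw [(hrv h).1, ← ha, WithTop.untopD_coe]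
  have hfun : ({ω | jumpTime w q i ω ≤ stopAt τ t ω}.indicator fun ω => f (jumpPoint w u q i ω)) =
      {ω | jumpTime w q i ω ≤ stopAt τ t ω}.indicator fun ω => f ((r ω, ω), v ω) := by
    refine Set.indicator_congr fun ω hω => ?_
    have h : jumpTime w q i ω ≤ t := by
      rw [hset] at hω
      exact hω.1
    rw [jumpPoint, (hrv h).1, (hrv h).2]
  rw [hfun]
  refine (hf.comp_measurable hΦ).indicator ?_
  rw [hset]
  exact (hle le_rfl).inter (hΦ₁ (measurableSet_predictable_le hτ))

end Adapted

/-! ### The compensated sum over the jumps -/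

section JumpSum

variable {Ω : Type*} {w : ℕ → Ω → ℝ} {u : ℕ → Ω → unitInterval} {q : ℝ≥0 → Ω → ℝ≥0}
  {E : Type*} [NormedAddCommGroup E]

/-- The sum of `f` over the jumps up to the random time `ρ`; it is `0` if infinitely many terms are
nonzero, which almost surely does not happen for `ρ < ζ`. -/
noncomputable def jumpSum (w : ℕ → Ω → ℝ) (u : ℕ → Ω → unitInterval) (q : ℝ≥0 → Ω → ℝ≥0)
    (f : (ℝ≥0 × Ω) × unitInterval → E) (ρ : Ω → ℝ≥0) (ω : Ω) : E :=
  ∑ᶠ i, {ω | jumpTime w q i ω ≤ ρ ω}.indicator (fun ω => f (jumpPoint w u q i ω)) ω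

/-- The compensator `∫₀^ρ q_t ∫₀¹ f(t, v) dv dt` of `jumpSum`. -/
noncomputable def rateIntegral [NormedSpace ℝ E] (q : ℝ≥0 → Ω → ℝ≥0)
    (f : (ℝ≥0 × Ω) × unitInterval → E) (ρ : Ω → ℝ≥0) (ω : Ω) : E :=
  ∫ a in Set.Iic (ρ ω), (q a ω : ℝ) • (∫ v, f ((a, ω), v)) ∂leb

variable {f : (ℝ≥0 × Ω) × unitInterval → E}

theorem jumpSum_indicator {τ : Ω → WithTop ℝ≥0} {s t : ℝ≥0} (hst : s ≤ t) {ω : Ω}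
    (hfin : {i | jumpTime w q i ω ≤ stopAt τ t ω}.Finite) (C : Set Ω) :
    jumpSum w u q (((Set.Ioi s ×ˢ C) ×ˢ Set.univ).indicator f) (stopAt τ t) ω =
      C.indicator (fun ω => jumpSum w u q f (stopAt τ t) ω - jumpSum w u q f (stopAt τ s) ω) ω := by
  classical
  by_cases hω : ω ∈ C
  · rw [Set.indicator_of_mem hω, jumpSum, jumpSum, jumpSum, ← finsum_sub_distrib]
    · refine finsum_congr fun i => ?_
      have h1 : ω ∈ {ω | jumpTime w q i ω ≤ stopAt τ s ω} ↔
          ω ∈ {ω | jumpTime w q i ω ≤ stopAt τ t ω} ∧ jumpTime w q i ω ≤ s :=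
        le_coe_stopAt_iff_of_le hst
      have h2 : jumpTime w q i ω ≤ stopAt τ t ω →
          (jumpPoint w u q i ω ∈ (Set.Ioi s ×ˢ C) ×ˢ Set.univ ↔ ¬ jumpTime w q i ω ≤ s) := by
        intro h
        rw [← jumpTime_untopD_le_iff (ne_top_of_le_ne_top WithTop.coe_ne_top h)]
        simp [jumpPoint, hω]
      by_cases h3 : jumpTime w q i ω ≤ stopAt τ t ω
      · have h4 : ω ∈ {ω | jumpTime w q i ω ≤ stopAt τ t ω} := h3
        rw [Set.indicator_of_mem h4, Set.indicator_of_mem h4]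
        by_cases h5 : jumpTime w q i ω ≤ s
        · rw [Set.indicator_of_notMem (mt (h2 h3).1 (not_not.2 h5)),
            Set.indicator_of_mem (h1.2 ⟨h4, h5⟩), sub_self]
        · rw [Set.indicator_of_mem ((h2 h3).2 h5),
            Set.indicator_of_notMem (fun h => h5 (h1.1 h).2), sub_zero]
      · have h4 : ω ∉ {ω | jumpTime w q i ω ≤ stopAt τ t ω} := h3
        rw [Set.indicator_of_notMem h4, Set.indicator_of_notMem h4,
          Set.indicator_of_notMem (fun h => h4 (h1.1 h).1), sub_zero]
    · refine hfin.subset fun i hi => ?_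
      exact Set.mem_of_indicator_ne_zero (s := {ω | jumpTime w q i ω ≤ stopAt τ t ω}) hi
    · refine hfin.subset fun i hi => ?_
      exact ((le_coe_stopAt_iff_of_le hst).1
        (Set.mem_of_indicator_ne_zero (s := {ω | jumpTime w q i ω ≤ stopAt τ s ω}) hi)).1
  · rw [Set.indicator_of_notMem hω, jumpSum]
    refine (finsum_congr fun i => ?_).trans finsum_zero
    refine Set.indicator_apply_eq_zero.2 fun _ => Set.indicator_of_notMem (fun h => hω ?_) _
    exact h.1.2

theorem setIntegral_rateIntegral [NormedSpace ℝ E] {τ : Ω → WithTop ℝ≥0} {ω : Ω} (s t : ℝ≥0)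
    (hst : s ≤ t)
    (hint : Integrable (fun a => {p : ℝ≥0 × Ω | p.1 ≤ stopAt τ t p.2}.indicator
        (fun p => (q p.1 p.2 : ℝ) • ∫ v, f (p, v)) (a, ω)) leb) :
    ∫ a in Set.Ioi s, {p : ℝ≥0 × Ω | p.1 ≤ stopAt τ t p.2}.indicator
        (fun p => (q p.1 p.2 : ℝ) • ∫ v, f (p, v)) (a, ω) ∂leb =
      rateIntegral q f (stopAt τ t) ω - rateIntegral q f (stopAt τ s) ω := by
  have h1 : ∀ r, rateIntegral q f (stopAt τ r) ω =
      ∫ a, {p : ℝ≥0 × Ω | p.1 ≤ stopAt τ r p.2}.indicator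
        (fun p => (q p.1 p.2 : ℝ) • ∫ v, f (p, v)) (a, ω) ∂leb := fun r => by
    rw [rateIntegral, ← integral_indicator measurableSet_Iic]
    rfl
  have h2 : rateIntegral q f (stopAt τ s) ω =
      ∫ a in Set.Iic s, {p : ℝ≥0 × Ω | p.1 ≤ stopAt τ t p.2}.indicator
        (fun p => (q p.1 p.2 : ℝ) • ∫ v, f (p, v)) (a, ω) ∂leb := by
    rw [h1, ← integral_indicator measurableSet_Iic]
    congr 1
    ext a
    simp only [Set.indicator_apply, Set.mem_ofPred_eq, Set.mem_Iic, le_stopAt_iff_of_le hst]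
    by_cases h3 : a ≤ s <;> simp [h3]
  rw [h2, h1, ← Set.compl_Iic, eq_sub_iff_add_eq']
  exact integral_add_compl measurableSet_Iic hint

variable [mΩ : MeasurableSpace Ω] {P : Measure Ω}

/-- Almost surely there are only finitely many jumps up to a time before explosion. -/
theorem ae_finite_jumpTime_le (hwu : IsMarkedPoisson P w u) {ρ : Ω → ℝ≥0}
    (hρ : ∀ ω, (ρ ω : WithTop ℝ≥0) < explosionTime q ω) :
    ∀ᵐ ω ∂P, {i | jumpTime w q i ω ≤ ρ ω}.Finite := by
  filter_upwards [hwu.ae_tendsto_sum] with ω hω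
  obtain ⟨N, hN⟩ := ((tendsto_add_atTop_iff_nat 1).2 hω).eventually_gt_atTop
    (cumRate q (ρ ω) ω).toReal |>.exists_forall_of_atTop
  refine (Set.finite_lt_nat N).subset fun i hi => ?_
  by_contra! hle
  have h1 := (jumpTime_le_iff_le_cumRate (hρ ω)).1 hi
  rw [ENNReal.ofReal_le_iff_le_toReal (cumRate_lt_top (hρ ω)).ne] at h1
  exact absurd h1 (not_le.2 (hN i (not_lt.1 hle)))

section Integral

variable {ρ : Ω → ℝ≥0}

theorem integrable_jumpSum (hwu : IsMarkedPoisson P w u) (hq : Measurable (Function.uncurry q))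
    (hρ : Measurable ρ) (hρζ : ∀ ω, (ρ ω : WithTop ℝ≥0) < explosionTime q ω)
    (hf : StronglyMeasurable f) (hint : Integrable f (jumpMeasure P w u q ρ)) :
    Integrable (jumpSum w u q f ρ) P ∧
      ∀ [NormedSpace ℝ E],
        ∫ p, f p ∂(jumpMeasure P w u q ρ) = ∫ ω, jumpSum w u q f ρ ω ∂P := by
  let g : ℕ → Ω → E := fun i =>
    {ω | jumpTime w q i ω ≤ ρ ω}.indicator fun ω => f (jumpPoint w u q i ω)
  have hS : ∀ i, MeasurableSet {ω | jumpTime w q i ω ≤ ρ ω} := fun i =>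
    measurableSet_jumpTime_le_stopping hwu hq hρ i
  have hg : ∀ i, StronglyMeasurable (g i) := fun i =>
    (hf.comp_measurable (measurable_jumpPoint hwu hq i)).indicator (hS i)
  have h1 : ∑' i, ∫⁻ ω, ‖g i ω‖ₑ ∂P = ∫⁻ p, ‖f p‖ₑ ∂(jumpMeasure P w u q ρ) := by
    rw [jumpMeasure, lintegral_sum_measure]
    refine tsum_congr fun i => ?_
    rw [lintegral_map hf.enorm (measurable_jumpPoint hwu hq i), ← lintegral_indicator (hS i)]
    refine lintegral_congr fun ω => ?_
    simp only [g, enorm_indicator_eq_indicator_enorm]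
  have h2 : ∑' i, ∫⁻ ω, ‖g i ω‖ₑ ∂P ≠ ∞ := h1 ▸ hint.2.ne
  have h3 : jumpSum w u q f ρ =ᵐ[P] fun ω => ∑' i, g i ω := by
    filter_upwards [ae_finite_jumpTime_le hwu hρζ] with ω hω
    refine (tsum_eq_finsum (hω.subset fun i hi => ?_)).symm
    exact Set.mem_of_indicator_ne_zero (s := {ω | jumpTime w q i ω ≤ ρ ω}) hi
  refine ⟨⟨(stronglyMeasurable_finsum hg).aestronglyMeasurable, ?_⟩, ?_⟩
  · rw [hasFiniteIntegral_iff_enorm]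
    calc ∫⁻ ω, ‖jumpSum w u q f ρ ω‖ₑ ∂P = ∫⁻ ω, ‖∑' i, g i ω‖ₑ ∂P :=
          lintegral_congr_ae (h3.mono fun ω h => by simp only [h])
      _ ≤ ∫⁻ ω, ∑' i, ‖g i ω‖ₑ ∂P := lintegral_mono fun ω => enorm_tsum_le_tsum_enorm
      _ = ∑' i, ∫⁻ ω, ‖g i ω‖ₑ ∂P := lintegral_tsum fun i => (hg i).enorm.aemeasurable
      _ < ∞ := h2.lt_top
  · intro _
    rw [integral_congr_ae h3, integral_tsum (fun i => (hg i).aestronglyMeasurable) h2]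
    rw [jumpMeasure] at hint ⊢
    rw [integral_sum_measure hint]
    refine tsum_congr fun i => ?_
    rw [integral_map (measurable_jumpPoint hwu hq i).aemeasurable hf.aestronglyMeasurable,
      ← integral_indicator (hS i)]

theorem clockMeasure_eq_withDensity (P : Measure Ω) (q : ℝ≥0 → Ω → ℝ≥0) (ρ : Ω → ℝ≥0) :
    clockMeasure P q ρ = (leb.prod P).withDensity fun p =>
      ({p : ℝ≥0 × Ω | p.1 ≤ ρ p.2}.indicator (Function.uncurry q) p : ℝ≥0) := by
  rw [clockMeasure]
  congr 1
  ext p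
  rw [ENNReal.coe_indicator]
  rfl

variable [NormedSpace ℝ E]

/-- The rate integral as an integral over `[0, ∞) × Ω`. -/
theorem integrable_rateIntegral [SFinite P] (hq : Measurable (Function.uncurry q))
    (hρ : Measurable ρ) (hint : Integrable f ((clockMeasure P q ρ).prod volume)) :
    Integrable ({p : ℝ≥0 × Ω | p.1 ≤ ρ p.2}.indicator
        fun p => (q p.1 p.2 : ℝ) • ∫ v, f (p, v)) (leb.prod P) ∧
      ∀ {S : Set (ℝ≥0 × Ω)}, MeasurableSet S →
        ∫ p in S ×ˢ Set.univ, f p ∂((clockMeasure P q ρ).prod volume) =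
        ∫ p in S, {p : ℝ≥0 × Ω | p.1 ≤ ρ p.2}.indicator
          (fun p => (q p.1 p.2 : ℝ) • ∫ v, f (p, v)) p ∂(leb.prod P) := by
  have hm : Measurable ({p : ℝ≥0 × Ω | p.1 ≤ ρ p.2}.indicator (Function.uncurry q)) :=
    hq.indicator (measurableSet_le_stopping hρ)
  have h1 : ({p : ℝ≥0 × Ω | p.1 ≤ ρ p.2}.indicator fun p => (q p.1 p.2 : ℝ) • ∫ v, f (p, v)) =
      fun p => {p : ℝ≥0 × Ω | p.1 ≤ ρ p.2}.indicator (Function.uncurry q) p • ∫ v, f (p, v) := by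
    ext p
    by_cases hp : p ∈ {p : ℝ≥0 × Ω | p.1 ≤ ρ p.2}
    · rw [Set.indicator_of_mem hp, Set.indicator_of_mem hp]
      rfl
    · rw [Set.indicator_of_notMem hp, Set.indicator_of_notMem hp, zero_smul]
  have hsf : SFinite (clockMeasure P q ρ) := by
    rw [clockMeasure_eq_withDensity]; infer_instance
  rw [h1]
  constructor
  · rw [← integrable_withDensity_iff_integrable_smul hm, ← clockMeasure_eq_withDensity]
    exact hint.integral_prod_left
  · intro S hS
    rw [← Measure.prod_restrict, Measure.restrict_univ, integral_prod]
    · rw [clockMeasure_eq_withDensity, restrict_withDensity hS,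
        integral_withDensity_eq_integral_smul hm]
    · have h2 := hint.restrict (s := S ×ˢ Set.univ)
      rwa [← Measure.prod_restrict, Measure.restrict_univ] at h2

end Integral

variable {τ : Ω → WithTop ℝ≥0}

theorem lintegral_cumRate_stopAt_lt_top [IsFiniteMeasure P] {n : ℕ}
    (hτn : ∀ ω, τ ω ≤ rateHit q n ω) (t : ℝ≥0) :
    ∫⁻ ω, cumRate q (stopAt τ t ω) ω ∂P < ∞ := by
  calc ∫⁻ ω, cumRate q (stopAt τ t ω) ω ∂P ≤ ∫⁻ _, (n * t : ℝ≥0∞) ∂P := by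
        refine lintegral_mono fun ω => (cumRate_le_mul (coe_stopAt_le.trans (hτn ω))).trans ?_
        gcongr
        exact stopAt_le
    _ < ∞ := by
        rw [lintegral_const]
        exact ENNReal.mul_lt_top (by finiteness) (measure_lt_top _ _)

/-- Bounded predictable functions are integrable for the jump measure and its compensator. -/
theorem integrable_predictable (hwu : IsMarkedPoisson P w u) (hq : Measurable (Function.uncurry q))
    (hrate : IsTransitionRate (jumpFiltration hwu.measurable_w hwu.measurable_u hq) q)
    (hτ : IsStoppingTime (jumpFiltration hwu.measurable_w hwu.measurable_u hq) τ)
    (hτζ : ∀ ω, τ ω < explosionTime q ω ∨ explosionTime q ω = ⊤)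
    {n : ℕ} (hτn : ∀ ω, τ ω ≤ rateHit q n ω)
    (hf : StronglyMeasurable[(jumpFiltration hwu.measurable_w hwu.measurable_u
      hq).predictable.prod inferInstance] f)
    {c : ℝ} (hc : ∀ᵐ p ∂((leb.prod P).prod volume), ‖f p‖ ≤ c) (t : ℝ≥0) :
    Integrable f ((clockMeasure P q (stopAt τ t)).prod volume) ∧
      Integrable f (jumpMeasure P w u q (stopAt τ t)) := by
  have := hwu.isProbabilityMeasure
  have hle := predictable_prod_le (jumpFiltration hwu.measurable_w hwu.measurable_u hq)
  have hfin := (lintegral_cumRate_stopAt_lt_top (P := P) hτn t)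
  have hρ := measurableSet_stopAt_le hτ t
  have hclock : IsFiniteMeasure (clockMeasure P q (stopAt τ t)) := ⟨by
    rw [← Set.univ_prod_univ, clockMeasure_univ_prod hq (measurable_of_stopping hρ)
      MeasurableSet.univ]
    simpa using hfin⟩
  have h1 : Integrable f ((clockMeasure P q (stopAt τ t)).prod volume) := by
    refine Integrable.of_bound (hf.mono hle).aestronglyMeasurable c ?_
    have h2 : clockMeasure P q (stopAt τ t) ≪ leb.prod P := withDensity_absolutelyContinuous _ _
    exact (h2.prod Measure.AbsolutelyContinuous.rfl).ae_le hc
  refine ⟨h1, integrable_of_integrable_trim hle ?_⟩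
  rw [trim_jumpMeasure_eq hwu hq hrate hρ (coe_stopAt_lt hτζ t) hfin.ne]
  exact h1.trim hle hf

variable [NormedSpace ℝ E]

theorem progressive_rate_smul {𝓕 : Filtration ℝ≥0 mΩ} (hrate : IsTransitionRate 𝓕 q)
    (hf : StronglyMeasurable[𝓕.predictable.prod inferInstance] f) :
    IsStronglyProgressive 𝓕
      (before (explosionTime q) fun a ω => (q a ω : ℝ) • ∫ v, f ((a, ω), v)) := by
  have hK : IsStronglyPredictable 𝓕 fun a ω => ∫ v, f ((a, ω), v) :=
    @StronglyMeasurable.integral_prod_right' _ _ _ 𝓕.predictable _ _ _ _ _ _ hf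
  intro t
  have h1 := ((NNReal.continuous_coe.comp_stronglyMeasurable (hrate.progressive t))).smul
    (hK.isStronglyProgressive t)
  convert h1 using 2 with p
  change _ = ((before (explosionTime q) q p.1 p.2 : ℝ≥0) : ℝ) • ∫ v, f (((p.1 : ℝ≥0), p.2), v)
  by_cases hp : ((p.1 : ℝ≥0) : WithTop ℝ≥0) < explosionTime q p.2
  · rw [before_of_lt hp, before_of_lt hp]
  · rw [before_of_not_lt hp, before_of_not_lt hp, NNReal.coe_zero, zero_smul]

/-- The sum of a bounded predictable function over the jumps, minus its compensator, is a
martingale when stopped at a time up to which the rate is bounded. -/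
theorem martingale_jumpSum_sub_rateIntegral [CompleteSpace E] (hwu : IsMarkedPoisson P w u)
    (hq : Measurable (Function.uncurry q))
    (hrate : IsTransitionRate (jumpFiltration hwu.measurable_w hwu.measurable_u hq) q)
    (hτ : IsStoppingTime (jumpFiltration hwu.measurable_w hwu.measurable_u hq) τ)
    (hτζ : ∀ ω, τ ω < explosionTime q ω ∨ explosionTime q ω = ⊤)
    {n : ℕ} (hτn : ∀ ω, τ ω ≤ rateHit q n ω)
    (hf : StronglyMeasurable[(jumpFiltration hwu.measurable_w hwu.measurable_u
      hq).predictable.prod inferInstance] f)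
    {c : ℝ} (hc : ∀ᵐ p ∂((leb.prod P).prod volume), ‖f p‖ ≤ c) :
    Martingale (fun t ω => jumpSum w u q f (stopAt τ t) ω - rateIntegral q f (stopAt τ t) ω)
      (jumpFiltration hwu.measurable_w hwu.measurable_u hq) P := by
  have := hwu.isProbabilityMeasure
  set 𝓕 := jumpFiltration hwu.measurable_w hwu.measurable_u hq
  have hle := predictable_prod_le 𝓕
  have hf' : StronglyMeasurable f := hf.mono hle
  have hρ := fun t => measurableSet_stopAt_le hτ t
  have hρm : ∀ t, Measurable (stopAt τ t) := fun t => measurable_of_stopping (hρ t)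
  have hρζ := fun t => coe_stopAt_lt hτζ t
  have hint := fun t => integrable_predictable hwu hq hrate hτ hτζ hτn hf hc t
  have hJ := fun t => (integrable_jumpSum hwu hq (hρm t) (hρζ t) hf' (hint t).2).1
  have hG := fun t => (integrable_rateIntegral hq (hρm t) (hint t).1).1
  have hI : ∀ t, Integrable (rateIntegral q f (stopAt τ t)) P := fun t => by
    refine (hG t).integral_prod_right.congr (ae_of_all _ fun ω => ?_)
    simp only [rateIntegral]
    rw [← integral_indicator measurableSet_Iic]
    rfl
  have hadJ : ∀ t, StronglyMeasurable[𝓕 t] (jumpSum w u q f (stopAt τ t)) := fun t =>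
    stronglyMeasurable_finsum (m := 𝓕 t) fun i =>
      stronglyMeasurable_indicator_jumpPoint hf hτ t i
  have hadI : ∀ t, StronglyMeasurable[𝓕 t] (rateIntegral q f (stopAt τ t)) := fun t => by
    exact stronglyMeasurable_setIntegral_stopAt (progressive_rate_smul hrate hf) hτ hτζ t
  refine ⟨fun t => (hadJ t).sub (hadI t), fun s t hst => ?_⟩
  refine (ae_eq_condExp_of_forall_setIntegral_eq (𝓕.le s) ((hJ t).sub (hI t))
    (fun C _ _ => ((hJ s).sub (hI s)).integrableOn) (fun C hC _ => ?_)
    ((hadJ s).sub (hadI s)).aestronglyMeasurable).symm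
  have hCm : MeasurableSet C := 𝓕.le _ _ hC
  have hS : MeasurableSet[𝓕.predictable] (Set.Ioi s ×ˢ C) :=
    measurableSet_predictable_Ioi_prod hC
  have hS' : MeasurableSet[𝓕.predictable.prod inferInstance]
      ((Set.Ioi s ×ˢ C) ×ˢ (Set.univ : Set unitInterval)) :=
    @MeasurableSet.prod _ _ 𝓕.predictable _ _ _ hS MeasurableSet.univ
  have hF := hf.indicator hS'
  have hjump : ∫ p, ((Set.Ioi s ×ˢ C) ×ˢ Set.univ).indicator f p
      ∂(jumpMeasure P w u q (stopAt τ t)) =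
      ∫ ω in C, (jumpSum w u q f (stopAt τ t) ω - jumpSum w u q f (stopAt τ s) ω) ∂P := by
    rw [(integrable_jumpSum hwu hq (hρm t) (hρζ t) (hF.mono hle)
      ((hint t).2.indicator (hle _ hS'))).2, ← integral_indicator hCm]
    refine integral_congr_ae ?_
    filter_upwards [ae_finite_jumpTime_le hwu (hρζ t)] with ω hω
    exact jumpSum_indicator hst hω C
  have hclock : ∫ p, ((Set.Ioi s ×ˢ C) ×ˢ Set.univ).indicator f p
      ∂((clockMeasure P q (stopAt τ t)).prod volume) =
      ∫ ω in C, (rateIntegral q f (stopAt τ t) ω - rateIntegral q f (stopAt τ s) ω) ∂P := by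
    rw [integral_indicator (hle _ hS'), (integrable_rateIntegral hq (hρm t) (hint t).1).2
      (measurableSet_Ioi.prod hCm)]
    have h1 := (hG t).restrict (s := Set.Ioi s ×ˢ C)
    rw [← Measure.prod_restrict] at h1 ⊢
    rw [integral_prod_symm _ h1]
    refine integral_congr_ae ?_
    filter_upwards [ae_restrict_of_ae (hG t).prod_left_ae] with ω hω
    exact setIntegral_rateIntegral s t hst hω
  have heq : ∫ ω in C, (jumpSum w u q f (stopAt τ t) ω - jumpSum w u q f (stopAt τ s) ω) ∂P =
      ∫ ω in C, (rateIntegral q f (stopAt τ t) ω - rateIntegral q f (stopAt τ s) ω) ∂P := by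
    rw [← hjump, ← hclock, integral_trim hle hF, integral_trim hle hF,
      trim_jumpMeasure_eq hwu hq hrate (hρ t) (hρζ t)
        (lintegral_cumRate_stopAt_lt_top (P := P) hτn t).ne]
  rw [integral_sub (hJ t).integrableOn (hJ s).integrableOn,
    integral_sub (hI t).integrableOn (hI s).integrableOn] at heq
  simp only [Pi.sub_apply]
  rw [integral_sub (hJ t).integrableOn (hI t).integrableOn,
    integral_sub (hJ s).integrableOn (hI s).integrableOn]
  rw [sub_eq_sub_iff_add_eq_add] at heq ⊢
  rw [add_comm, ← heq, add_comm]

end JumpSum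

/-! ### Hybrid jump processes -/

section Hybrid

variable {Ω : Type*} {q : ℝ≥0 → Ω → ℝ≥0} {E : Type*} [NormedAddCommGroup E]
  {D : ℝ≥0 → Ω → E}

theorem lintegral_enorm_le_of_le_derivHit {n : ℕ} {ρ : ℝ≥0} {ω : Ω} (h : ρ ≤ derivHit q D n ω) :
    ∫⁻ s in Set.Iic ρ, ‖D s ω‖ₑ ∂leb ≤ n := by
  have h1 : ∀ a < ρ, ∫⁻ s in Set.Iic a, ‖D s ω‖ₑ ∂leb ≤ n := fun a ha => by
    have h2 := notMem_of_lt_hittingAfter (((WithTop.coe_lt_coe.2 ha).trans_le h).trans_le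
      (min_le_right _ _)) zero_le
    exact (not_le.1 h2).le
  rw [← setLIntegral_congr (Iio_ae_eq_Iic (μ := leb))]
  rcases eq_zero_or_pos ρ with rfl | hρ
  · rw [← bot_eq_zero, Set.Iio_bot, setLIntegral_empty]
    exact zero_le
  · obtain ⟨a, ha, haρ, hlim⟩ := exists_seq_strictMono_tendsto' hρ
    rw [← iUnion_Iic_eq_Iio_of_lt_of_tendsto (fun i => (haρ i).2) hlim,
      setLIntegral_iUnion_of_directed _
        (Monotone.directed_le fun i j hij => Set.Iic_subset_Iic.2 (ha.monotone hij))]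
    exact iSup_le fun i => h1 _ (haρ i).2

/-- The jump function as a function on `([0, ∞) × Ω) × [0, 1]`, extended by `0` from `[0, ζ)`. -/
noncomputable def jumpFunction (q : ℝ≥0 → Ω → ℝ≥0) (Δ : ℝ≥0 → Ω → unitInterval → E)
    (p : (ℝ≥0 × Ω) × unitInterval) : E :=
  before (explosionTime q) Δ p.1.1 p.1.2 p.2

theorem jumpFunction_of_lt {Δ : ℝ≥0 → Ω → unitInterval → E} {t : ℝ≥0} {ω : Ω}
    (h : (t : WithTop ℝ≥0) < explosionTime q ω) (v : unitInterval) : jumpFunction q Δ ((t, ω), v) = Δ t ω v :=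
  congrFun (before_of_lt h) v

variable [mΩ : MeasurableSpace Ω] {P : Measure Ω}

theorem IsLocalizingFor.min {𝓕 : Filtration ℝ≥0 mΩ} {ζ : Ω → WithTop ℝ≥0}
    {τ σ : ℕ → Ω → WithTop ℝ≥0} (hτ : IsLocalizingFor 𝓕 ζ τ) (hσ : IsLocalizingFor 𝓕 ζ σ) :
    IsLocalizingFor 𝓕 ζ fun n ω => min (τ n ω) (σ n ω) where
  isStoppingTime n := (hτ.isStoppingTime n).min (hσ.isStoppingTime n)
  monotone ω := (hτ.monotone ω).min (hσ.monotone ω)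
  tendsto ω := by simpa using (hτ.tendsto ω).min (hσ.tendsto ω)

theorem IsTransitionRate.rateHit_lt {𝓕 : Filtration ℝ≥0 mΩ} (h : IsTransitionRate 𝓕 q) (n : ℕ)
    (ω : Ω) : rateHit q n ω < explosionTime q ω ∨ explosionTime q ω = ⊤ := by
  refine (em (explosionTime q ω = ⊤)).symm.imp_left fun hω => ?_
  obtain ⟨t, ht, hn⟩ := h.unbounded ω hω n
  exact (rateHit_le_of_le hn).trans_lt ht

theorem aestronglyMeasurable_of_progressive {𝓕 : Filtration ℝ≥0 mΩ} {Y : ℝ≥0 → Ω → E}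
    (hY : IsStronglyProgressive 𝓕 Y) (t : ℝ≥0) (ω : Ω) :
    AEStronglyMeasurable (fun s => Y s ω) (leb.restrict (Set.Iic t)) := by
  rw [← map_comap_subtype_coe measurableSet_Iic,
    (MeasurableEmbedding.subtype_coe measurableSet_Iic).aestronglyMeasurable_map_iff]
  have h1 : StronglyMeasurable fun s : Set.Iic t => Y s ω :=
    (hY t).comp_measurable (@measurable_prodMk_right _ _ _ (𝓕 t) ω)
  exact h1.aestronglyMeasurable

/-- A time up to which the rate and the integral of the derivative are bounded. -/
structure IsReducing (𝓕 : Filtration ℝ≥0 mΩ) (q : ℝ≥0 → Ω → ℝ≥0) (D : ℝ≥0 → Ω → E) (n : ℕ)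
    (τ : Ω → WithTop ℝ≥0) : Prop where
  isStoppingTime : IsStoppingTime 𝓕 τ
  lt_explosionTime : ∀ ω, τ ω < explosionTime q ω ∨ explosionTime q ω = ⊤
  le_rateHit : ∀ ω, τ ω ≤ rateHit q n ω
  le_derivHit : ∀ ω, τ ω ≤ derivHit q D n ω

variable [NormedSpace ℝ E] [CompleteSpace E]
  {w : ℕ → Ω → ℝ} {u : ℕ → Ω → unitInterval} {x₀ : E} {Δ : ℝ≥0 → Ω → unitInterval → E}
  {X : ℝ≥0 → Ω → E} {𝓕 : Filtration ℝ≥0 mΩ} {τ : Ω → WithTop ℝ≥0}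

namespace IsHybridJumpProcess

theorem exists_ae_norm_jumpFunction_le (h : IsHybridJumpProcess P w u 𝓕 q x₀ D Δ X) :
    ∃ c : ℝ, ∀ᵐ p ∂((leb.prod P).prod volume), ‖jumpFunction q Δ p‖ ≤ c := by
  obtain ⟨c, hc⟩ := h.bounded
  refine ⟨|c|, hc.mono fun p hp => ?_⟩
  by_cases h1 : (p.1.1 : WithTop ℝ≥0) < explosionTime q p.1.2
  · rw [show p = ((p.1.1, p.1.2), p.2) from rfl, jumpFunction_of_lt h1]
    exact (hp h1).trans (le_abs_self c)
  · rw [jumpFunction, before_of_not_lt h1, Pi.zero_apply, norm_zero]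
    exact abs_nonneg c

theorem stopped_eq (h : IsHybridJumpProcess P w u 𝓕 q x₀ D Δ X)
    (hτζ : ∀ ω, τ ω < explosionTime q ω ∨ explosionTime q ω = ⊤) (t : ℝ≥0) (ω : Ω) :
    X (stopAt τ t ω) ω = x₀ + ∫ s in Set.Iic (stopAt τ t ω), D s ω ∂leb +
      jumpSum w u q (jumpFunction q Δ) (stopAt τ t) ω := by
  rw [h.eq _ _ (coe_stopAt_lt hτζ t ω), finsum_mem_def, jumpSum]
  congr 1
  refine finsum_congr fun i => ?_
  by_cases h1 : jumpTime w q i ω ≤ stopAt τ t ω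
  · rw [Set.indicator_of_mem (show i ∈ {i | jumpTime w q i ω ≤ stopAt τ t ω} from h1),
      Set.indicator_of_mem (show ω ∈ {ω | jumpTime w q i ω ≤ stopAt τ t ω} from h1), jumpPoint,
      jumpFunction_of_lt]
    obtain ⟨a, ha⟩ := WithTop.ne_top_iff_exists.1 (ne_top_of_le_ne_top WithTop.coe_ne_top h1)
    rw [← ha] at h1 ⊢
    exact h1.trans_lt (coe_stopAt_lt hτζ t ω)
  · rw [Set.indicator_of_notMem (show i ∉ {i | jumpTime w q i ω ≤ stopAt τ t ω} from h1),
      Set.indicator_of_notMem (show ω ∉ {ω | jumpTime w q i ω ≤ stopAt τ t ω} from h1)]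

theorem progressive_drift (h : IsHybridJumpProcess P w u 𝓕 q x₀ D Δ X) :
    IsStronglyProgressive 𝓕 (before (explosionTime q) (drift q D Δ)) := by
  intro t
  convert (h.progressive t).add (progressive_rate_smul h.rate h.predictable t) using 2 with p
  change _ = before (explosionTime q) D p.1 p.2 +
    before (explosionTime q) (fun a ω => (q a ω : ℝ) • ∫ v, jumpFunction q Δ ((a, ω), v)) p.1 p.2
  by_cases hp : ((p.1 : ℝ≥0) : WithTop ℝ≥0) < explosionTime q p.2
  · simp only [before_of_lt hp, drift, jumpFunction_of_lt hp]
  · rw [before_of_not_lt hp, before_of_not_lt hp, before_of_not_lt hp, add_zero]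

theorem integrableOn_deriv (h : IsHybridJumpProcess P w u 𝓕 q x₀ D Δ X)
    (hτζ : ∀ ω, τ ω < explosionTime q ω ∨ explosionTime q ω = ⊤)
    {n : ℕ} (hτD : ∀ ω, τ ω ≤ derivHit q D n ω) (t : ℝ≥0) (ω : Ω) :
    IntegrableOn (fun s => D s ω) (Set.Iic (stopAt τ t ω)) leb := by
  refine ⟨(aestronglyMeasurable_of_progressive h.progressive _ ω).congr ?_, ?_⟩
  · filter_upwards [ae_restrict_mem measurableSet_Iic] with s hs
    exact before_of_lt ((WithTop.coe_le_coe.2 hs).trans_lt (coe_stopAt_lt hτζ t ω))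
  · exact (lintegral_enorm_le_of_le_derivHit (coe_stopAt_le.trans (hτD ω))).trans_lt
      (ENNReal.natCast_lt_top n)

theorem integrable_deriv [IsFiniteMeasure P] (h : IsHybridJumpProcess P w u 𝓕 q x₀ D Δ X)
    (hτ : IsStoppingTime 𝓕 τ) (hτζ : ∀ ω, τ ω < explosionTime q ω ∨ explosionTime q ω = ⊤)
    {n : ℕ} (hτD : ∀ ω, τ ω ≤ derivHit q D n ω) (t : ℝ≥0) :
    Integrable (fun ω => ∫ s in Set.Iic (stopAt τ t ω), D s ω ∂leb) P := by
  refine Integrable.of_bound ((stronglyMeasurable_setIntegral_stopAt h.progressive hτ hτζ t).mono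
    (𝓕.le t)).aestronglyMeasurable n (ae_of_all _ fun ω => ?_)
  have h1 := (enorm_integral_le_lintegral_enorm _).trans
    (lintegral_enorm_le_of_le_derivHit (coe_stopAt_le.trans (hτD ω)) :
      ∫⁻ s in Set.Iic (stopAt τ t ω), ‖D s ω‖ₑ ∂leb ≤ n)
  rw [← ofReal_norm, ENNReal.ofReal_le_iff_le_toReal (ENNReal.natCast_ne_top n)] at h1
  simpa using h1

end IsHybridJumpProcess

/-- It suffices to stop at reducing times. -/
theorem IsHybridJumpProcess.locallyOn (h : IsHybridJumpProcess P w u 𝓕 q x₀ D Δ X) {F : Type*}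
    {p : (ℝ≥0 → Ω → F) → Prop} {Y : ℝ≥0 → Ω → F}
    (hp : ∀ n τ, IsReducing 𝓕 q D n τ → p (stoppedProcess Y τ)) :
    LocallyOn 𝓕 (explosionTime q) p Y := by
  have h1 := h.rate.localizing.min h.deriv_localizing
  have h2 : ∀ n ω, min (rateHit q n ω) (derivHit q D n ω) < explosionTime q ω ∨
      explosionTime q ω = ⊤ := fun n ω =>
    (h.rate.rateHit_lt n ω).imp_left fun h => (min_le_left _ _).trans_lt h
  exact ⟨_, h1, h2, fun n => hp n _ ⟨h1.isStoppingTime n, h2 n, fun ω => min_le_left _ _,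
    fun ω => min_le_right _ _⟩⟩

section Reduced

variable {hw : ∀ i, Measurable (w i)} {hu : ∀ i, Measurable (u i)}
  {hq : Measurable (Function.uncurry q)} {n : ℕ}

/-- The stopped jumps, compensated. -/
theorem IsHybridJumpProcess.martingale (hwu : IsMarkedPoisson P w u)
    (h : IsHybridJumpProcess P w u (jumpFiltration hw hu hq) q x₀ D Δ X)
    (hτ : IsReducing (jumpFiltration hw hu hq) q D n τ) :
    Martingale (fun t ω => jumpSum w u q (jumpFunction q Δ) (stopAt τ t) ω -
      rateIntegral q (jumpFunction q Δ) (stopAt τ t) ω) (jumpFiltration hw hu hq) P := by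
  obtain ⟨c, hc⟩ := h.exists_ae_norm_jumpFunction_le
  exact martingale_jumpSum_sub_rateIntegral hwu hq h.rate hτ.isStoppingTime hτ.lt_explosionTime
    hτ.le_rateHit h.predictable hc

/-- Up to a reducing time the drift is integrable, and its integral is that of the derivative
plus the compensator of the jumps. -/
theorem IsHybridJumpProcess.integral_drift (hwu : IsMarkedPoisson P w u)
    (h : IsHybridJumpProcess P w u (jumpFiltration hw hu hq) q x₀ D Δ X)
    (hτ : IsReducing (jumpFiltration hw hu hq) q D n τ) (t : ℝ≥0) :
    Integrable (fun ω => ∫ s in Set.Iic (stopAt τ t ω), drift q D Δ s ω ∂leb) P ∧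
    ∀ᵐ ω ∂P, IntegrableOn (fun s => drift q D Δ s ω) (Set.Iic (stopAt τ t ω)) leb ∧
      ∫ s in Set.Iic (stopAt τ t ω), drift q D Δ s ω ∂leb =
        ∫ s in Set.Iic (stopAt τ t ω), D s ω ∂leb +
          rateIntegral q (jumpFunction q Δ) (stopAt τ t) ω := by
  have := hwu.isProbabilityMeasure
  obtain ⟨c, hc⟩ := h.exists_ae_norm_jumpFunction_le
  have h1 := (integrable_predictable hwu hq h.rate hτ.isStoppingTime hτ.lt_explosionTime
    hτ.le_rateHit h.predictable hc t).1
  have h2 := (integrable_rateIntegral hq (measurable_of_stopping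
    (measurableSet_stopAt_le hτ.isStoppingTime t)) h1).1
  have h3 : Integrable (rateIntegral q (jumpFunction q Δ) (stopAt τ t)) P :=
    h2.integral_prod_right.congr (ae_of_all _ fun ω => by
      simp only [rateIntegral]
      rw [← integral_indicator measurableSet_Iic]
      rfl)
  have h4 : ∀ᵐ ω ∂P, IntegrableOn (fun s => drift q D Δ s ω) (Set.Iic (stopAt τ t ω)) leb ∧
      ∫ s in Set.Iic (stopAt τ t ω), drift q D Δ s ω ∂leb =
        ∫ s in Set.Iic (stopAt τ t ω), D s ω ∂leb +
          rateIntegral q (jumpFunction q Δ) (stopAt τ t) ω := by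
    filter_upwards [h2.prod_left_ae] with ω hω
    have h5 : IntegrableOn (fun s => (q s ω : ℝ) • ∫ v, jumpFunction q Δ ((s, ω), v))
        (Set.Iic (stopAt τ t ω)) leb := (integrable_indicator_iff measurableSet_Iic).1 hω
    have h6 := h.integrableOn_deriv hτ.lt_explosionTime hτ.le_derivHit t ω
    have h7 : Set.EqOn (fun s => D s ω + (q s ω : ℝ) • ∫ v, jumpFunction q Δ ((s, ω), v))
        (fun s => drift q D Δ s ω) (Set.Iic (stopAt τ t ω)) := fun s hs => by
      have h8 : (s : WithTop ℝ≥0) < explosionTime q ω :=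
        (WithTop.coe_le_coe.2 hs).trans_lt (coe_stopAt_lt hτ.lt_explosionTime t ω)
      simp only [drift, jumpFunction_of_lt h8]
    refine ⟨(h6.add h5).congr_fun h7 measurableSet_Iic, ?_⟩
    rw [← setIntegral_congr_fun measurableSet_Iic h7]
    exact integral_add h6 h5
  refine ⟨?_, h4⟩
  exact ((h.integrable_deriv hτ.isStoppingTime hτ.lt_explosionTime hτ.le_derivHit t).add h3).congr
    (h4.mono fun ω hω => hω.2.symm)

theorem IsHybridJumpProcess.ae_stopped_eq (hwu : IsMarkedPoisson P w u)
    (h : IsHybridJumpProcess P w u (jumpFiltration hw hu hq) q x₀ D Δ X)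
    (hτ : IsReducing (jumpFiltration hw hu hq) q D n τ) (t : ℝ≥0) :
    ∀ᵐ ω ∂P, X (stopAt τ t ω) ω = x₀ + (jumpSum w u q (jumpFunction q Δ) (stopAt τ t) ω -
        rateIntegral q (jumpFunction q Δ) (stopAt τ t) ω) +
      ∫ s in Set.Iic (stopAt τ t ω), drift q D Δ s ω ∂leb := by
  filter_upwards [(h.integral_drift hwu hτ t).2] with ω hω
  rw [h.stopped_eq hτ.lt_explosionTime, hω.2]
  abel

theorem IsHybridJumpProcess.stronglyMeasurable_drift
    (h : IsHybridJumpProcess P w u (jumpFiltration hw hu hq) q x₀ D Δ X)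
    (hτ : IsReducing (jumpFiltration hw hu hq) q D n τ) (t : ℝ≥0) :
    StronglyMeasurable[jumpFiltration hw hu hq t]
      fun ω => ∫ s in Set.Iic (stopAt τ t ω), drift q D Δ s ω ∂leb :=
  stronglyMeasurable_setIntegral_stopAt h.progressive_drift hτ.isStoppingTime
    hτ.lt_explosionTime t

theorem IsHybridJumpProcess.stronglyAdapted_stopped
    (h : IsHybridJumpProcess P w u (jumpFiltration hw hu hq) q x₀ D Δ X)
    (hτ : IsReducing (jumpFiltration hw hu hq) q D n τ) :
    StronglyAdapted (jumpFiltration hw hu hq) (stoppedProcess X τ) := fun t => by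
  have h1 : stoppedProcess X τ t = fun ω => x₀ + ∫ s in Set.Iic (stopAt τ t ω), D s ω ∂leb +
      jumpSum w u q (jumpFunction q Δ) (stopAt τ t) ω :=
    funext fun ω => h.stopped_eq hτ.lt_explosionTime t ω
  rw [h1]
  exact (stronglyMeasurable_const.add (stronglyMeasurable_setIntegral_stopAt h.progressive
    hτ.isStoppingTime hτ.lt_explosionTime t)).add (stronglyMeasurable_finsum fun i =>
      stronglyMeasurable_indicator_jumpPoint h.predictable hτ.isStoppingTime t i)

theorem ae_ae_of_ae_leb_prod [SFinite P] {p : ℝ≥0 × Ω → Prop} (h : ∀ᵐ a ∂(leb.prod P), p a) :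
    ∀ᵐ ω ∂P, ∀ᵐ s ∂leb, p (s, ω) :=
  Measure.ae_ae_of_ae_prod (Measure.measurePreserving_swap.quasiMeasurePreserving.ae h)

/-- The compensated process is a local martingale. -/
theorem IsHybridJumpProcess.isLocalMartingaleOn_sub_compensator (hwu : IsMarkedPoisson P w u)
    (h : IsHybridJumpProcess P w u (jumpFiltration hw hu hq) q x₀ D Δ X) :
    IsLocalMartingaleOn (jumpFiltration hw hu hq) P (explosionTime q)
      (fun t ω => X t ω - compensator q x₀ D Δ t ω) := by
  refine h.locallyOn fun n τ hτ => (h.martingale hwu hτ).congr (fun t => ?_) fun t => ?_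
  · exact (h.stronglyAdapted_stopped hτ t).sub
      (stronglyMeasurable_const.add (h.stronglyMeasurable_drift hτ t))
  · filter_upwards [h.ae_stopped_eq hwu hτ t] with ω hω
    change _ = X (stopAt τ t ω) ω -
      (x₀ + ∫ s in Set.Iic (stopAt τ t ω), drift q D Δ s ω ∂leb)
    rw [hω]
    abel

/-- Without drift the process is a local martingale. -/
theorem IsHybridJumpProcess.isLocalMartingaleOn (hwu : IsMarkedPoisson P w u)
    (h : IsHybridJumpProcess P w u (jumpFiltration hw hu hq) q x₀ D Δ X)
    (hzero : ∀ᵐ p : ℝ≥0 × Ω ∂(leb.prod P), (p.1 : WithTop ℝ≥0) < explosionTime q p.2 →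
      drift q D Δ p.1 p.2 = 0) :
    IsLocalMartingaleOn (jumpFiltration hw hu hq) P (explosionTime q) X := by
  have := hwu.isProbabilityMeasure
  refine h.locallyOn fun n τ hτ => ((martingale_const _ P x₀).add (h.martingale hwu hτ)).congr
    (h.stronglyAdapted_stopped hτ) fun t => ?_
  filter_upwards [h.ae_stopped_eq hwu hτ t, ae_ae_of_ae_leb_prod hzero] with ω hω hω'
  change _ = X (stopAt τ t ω) ω
  rw [hω, setIntegral_eq_zero_of_ae_eq_zero, add_zero]
  · rfl
  · filter_upwards [hω'] with s hs hsρ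
    exact hs ((WithTop.coe_le_coe.2 hsρ).trans_lt (coe_stopAt_lt hτ.lt_explosionTime t ω))

/-- With nonnegative drift the process is a local submartingale: the integral of the drift is
nondecreasing. -/
theorem IsHybridJumpProcess.isLocalSubmartingaleOn {x₀ : ℝ} {D : ℝ≥0 → Ω → ℝ}
    {Δ : ℝ≥0 → Ω → unitInterval → ℝ} {X : ℝ≥0 → Ω → ℝ} (hwu : IsMarkedPoisson P w u)
    (h : IsHybridJumpProcess P w u (jumpFiltration hw hu hq) q x₀ D Δ X)
    (hnonneg : ∀ᵐ p : ℝ≥0 × Ω ∂(leb.prod P), (p.1 : WithTop ℝ≥0) < explosionTime q p.2 →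
      0 ≤ drift q D Δ p.1 p.2) :
    IsLocalSubmartingaleOn (jumpFiltration hw hu hq) P (explosionTime q) X := by
  have := hwu.isProbabilityMeasure
  refine h.locallyOn fun n τ hτ => ?_
  have hint := fun t => (h.integral_drift hwu hτ t).1
  have hsub : Submartingale (fun t ω => ∫ s in Set.Iic (stopAt τ t ω), drift q D Δ s ω ∂leb)
      (jumpFiltration hw hu hq) P := by
    refine submartingale_of_setIntegral_le (fun t => h.stronglyMeasurable_drift hτ t) hint
      fun s t hst A _ => setIntegral_mono_ae (hint s).integrableOn (hint t).integrableOn ?_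
    filter_upwards [(h.integral_drift hwu hτ t).2, ae_ae_of_ae_leb_prod hnonneg] with ω hω hω'
    refine setIntegral_mono_set hω.1 ?_ (Set.Iic_subset_Iic.2 (stopAt_mono hst)).eventuallyLE
    filter_upwards [ae_restrict_of_ae hω', ae_restrict_mem measurableSet_Iic] with a ha haρ
    exact ha ((WithTop.coe_le_coe.2 haρ).trans_lt (coe_stopAt_lt hτ.lt_explosionTime t ω))
  refine (hsub.add_martingale ((martingale_const _ P x₀).add (h.martingale hwu hτ))).congr
    (h.stronglyAdapted_stopped hτ) fun t => ?_
  filter_upwards [h.ae_stopped_eq hwu hτ t] with ω hω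
  change _ = X (stopAt τ t ω) ω
  rw [hω, add_comm]
  rfl

end Reduced

end Hybrid

end HybridJump

theorem theorem1 {Ω : Type*} [mΩ : MeasurableSpace Ω] (P : Measure Ω) [IsProbabilityMeasure P]
    (w : ℕ → Ω → ℝ) (u : ℕ → Ω → unitInterval) (hwu : HybridJump.IsMarkedPoisson P w u)
    (q : ℝ≥0 → Ω → ℝ≥0) (hq : Measurable (Function.uncurry q))
    {E : Type*} [NormedAddCommGroup E] [NormedSpace ℝ E] [CompleteSpace E] :
    let 𝓕 : Filtration ℝ≥0 mΩ :=
      HybridJump.jumpFiltration hwu.measurable_w hwu.measurable_u hq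
    let ζ : Ω → WithTop ℝ≥0 := HybridJump.explosionTime q
    (∀ (x₀ : E) (D : ℝ≥0 → Ω → E) (Δ : ℝ≥0 → Ω → unitInterval → E) (X : ℝ≥0 → Ω → E),
      HybridJump.IsHybridJumpProcess P w u 𝓕 q x₀ D Δ X →
        ((∀ᵐ p : ℝ≥0 × Ω ∂(HybridJump.leb.prod P), (p.1 : WithTop ℝ≥0) < ζ p.2 →
            HybridJump.drift q D Δ p.1 p.2 = 0) →
          HybridJump.IsLocalMartingaleOn 𝓕 P ζ X) ∧
        HybridJump.IsLocalMartingaleOn 𝓕 P ζ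
          (fun t ω => X t ω - HybridJump.compensator q x₀ D Δ t ω)) ∧
    (∀ (x₀ : ℝ) (D : ℝ≥0 → Ω → ℝ) (Δ : ℝ≥0 → Ω → unitInterval → ℝ) (X : ℝ≥0 → Ω → ℝ),
      HybridJump.IsHybridJumpProcess P w u 𝓕 q x₀ D Δ X →
        (∀ᵐ p : ℝ≥0 × Ω ∂(HybridJump.leb.prod P), (p.1 : WithTop ℝ≥0) < ζ p.2 →
            0 ≤ HybridJump.drift q D Δ p.1 p.2) →
          HybridJump.IsLocalSubmartingaleOn 𝓕 P ζ X) := by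
  intro 𝓕 ζ
  exact ⟨fun x₀ D Δ X h => ⟨fun hzero => h.isLocalMartingaleOn hwu hzero,
    h.isLocalMartingaleOn_sub_compensator hwu⟩,
    fun x₀ D Δ X h hnonneg => h.isLocalSubmartingaleOn hwu hnonneg⟩
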